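/- Let $p$ be fixed, and let $Y_t=(Y_{1,t},\dots,Y_{p,t})'$, where all the entries $Y_{i,t}$ are i.i.d. real random variables with $\mathbb E Y_{i,t}=0$, $\mathbb E Y_{i,t}^2=1$, $\mathbb E Y_{i,t}^4<\infty$ and $\mu_4:=\mathbb E(Y_{i,t}^2-1)^2>0$. Let $A$ be a function with values in $\mathbb R^{p\times p}$, defined on $(0,1]$, whose entries are Lipschitz on $(0,1)$, and let $$X_t=A(t/T)Y_t,\qquad t=1,\dots,T .$$ Write $A^2(u)=A(u)A(u)'$ and $M(u)=A^2(u)-\int_0^1A^2(v)\,dv$. Let $K:\mathbb R\to\mathbb R$ be a symmetric integrable function of bounded variation with $\int K=1$ and $\int|v||K(v)|\,dv<\infty$; put $K_h(v)=h^{-1}K(h^{-1}v)$, $\|K\|_2^2=\int K(v)^2dv$ and $$\widehat A^2(u)=\frac1T\sum_{t=1}^TX_tX_t'K_h\Big(u-\frac tT\Big),\qquad \widehat M(u)=\widehat A^2(u)-\frac1T\sum_{t=1}^TX_tX_t'.$$ Fix $u\in(0,1)$ with $A(u)$ invertible, and let $T\to\infty$ and $h=h_T\to0$ so that $Th\to\infty$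 and $Th^3\to0$. Then $$\frac{\sqrt{Th}}{\|K\|_2\,\mu_4^{1/2}}\,A(u)^{-1}\big(\widehat M(u)-M(u)\big)A(u)'^{-1}\ \stackrel{d}{\longrightarrow}\ \mathcal Z_p ,$$ where $\mathcal Z_p$ is a symmetric $p\times p$ random matrix whose entries on and above the diagonal are independent centred normal variables, with variance $1$ on the diagonal and $1/\mu_4$ off the diagonal. Moreover, for a symmetric matrix $S$ let $S^{1/2}$ be the matrix obtained by applying $x\mapsto\sqrt{\max(x,0)}$ to the eigenvalues of $S$ (the usual square root if $S$ is positive semidefinite), and let $\widehat A(u)=(\widehat A^2(u))^{1/2}$. Then, in probability, $$\widehat A^2(u)\to A^2(u),\quad \big(\widehat A^2(u)\big)^{-1}\to \big(A^2(u)\big)^{-1},\quad \widehat A(u)\to \big(A^2(u)\big)^{1/2},\quad \widehat A(u)^{-1}\to\big(A^2(u)\big)^{-1/2}$$ (an inverse is given the value $0$ where it does not exist). Further, there is an orthogonal matrix $Q$ with $(A^2(u))^{1/2}Q=A(u)$, equal to the identity if $A(u)$ is symmetric positive definite, such that $\widehat A(u)Q\to A(u)$ and $(\widehat A(u)Q)^{-1}\to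 A(u)^{-1}$ in probability. -/

import Mathlib

open MeasureTheory ProbabilityTheory Filter Topology Set
open scoped Matrix

noncomputable section

namespace VCModel

/-- A kernel: a symmetric function on the line which integrates to `1`, with the regularity
conditions bounded variation and integrable first absolute moment (satisfied, e.g., by every
symmetric Lipschitz kernel with bounded support, in particular by the triangle kernel, by the
uniform kernel and by the Gaussian kernel). -/
structure IsKernel (K : ℝ → ℝ) : Prop where
  symm : ∀ v, K (-v) = K v
  integrable : Integrable K
  integral_eq_one : ∫ v, K v = 1
  boundedVariation : BoundedVariationOn K univ
  integrable_moment : Integrable (fun v => v * K v)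

/-- `K_h(v) = h⁻¹ K(h⁻¹ v)`. -/
def scaledKernel (K : ℝ → ℝ) (h v : ℝ) : ℝ := h⁻¹ * K (h⁻¹ * v)

/-- The `L²` norm `‖K‖₂` of a kernel. -/
def kernelNorm (K : ℝ → ℝ) : ℝ := √(∫ v, K v ^ 2)

/-- `μ₄ = E (Y² - 1)²` for a random variable `Y` with law `ν`. -/
def mu4 (ν : Measure ℝ) : ℝ := ∫ y, (y ^ 2 - 1) ^ 2 ∂ν

section Model

variable {p : ℕ} {Ω : Type*}

/-- `A²(u) = A(u) A(u)'`. -/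
def sq (A : ℝ → Matrix (Fin p) (Fin p) ℝ) (u : ℝ) : Matrix (Fin p) (Fin p) ℝ :=
  A u * (A u)ᵀ

/-- The entrywise integral `∫₀¹ A²(v) dv`. -/
def sqMean (A : ℝ → Matrix (Fin p) (Fin p) ℝ) : Matrix (Fin p) (Fin p) ℝ :=
  Matrix.of fun i j => ∫ v in (0 : ℝ)..1, sq A v i j

/-- `M(u) = A²(u) - ∫₀¹ A²(v) dv`. -/
def M (A : ℝ → Matrix (Fin p) (Fin p) ℝ) (u : ℝ) : Matrix (Fin p) (Fin p) ℝ :=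
  sq A u - sqMean A

/-- The observations `X_t = A(t/T) Y_t` of the varying covariance model with sample size `T`. -/
def X (A : ℝ → Matrix (Fin p) (Fin p) ℝ) (Y : ℕ → Ω → Fin p → ℝ) (T t : ℕ) (ω : Ω) :
    Fin p → ℝ :=
  A ((t : ℝ) / (T : ℝ)) *ᵥ Y t ω

/-- The kernel estimator `T⁻¹ ∑_{t=1}^T X_t X_t' K_h(u - t/T)` of `A²(u)`. -/
def sqHat (A : ℝ → Matrix (Fin p) (Fin p) ℝ) (Y : ℕ → Ω → Fin p → ℝ) (K : ℝ → ℝ)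
    (T : ℕ) (h u : ℝ) (ω : Ω) : Matrix (Fin p) (Fin p) ℝ :=
  (1 / (T : ℝ)) • ∑ t ∈ Finset.Icc 1 T,
    scaledKernel K h (u - (t : ℝ) / (T : ℝ)) • Matrix.vecMulVec (X A Y T t ω) (X A Y T t ω)

/-- The estimator `T⁻¹ ∑_{t=1}^T X_t X_t'` of `∫₀¹ A²(v) dv`. -/
def sqMeanHat (A : ℝ → Matrix (Fin p) (Fin p) ℝ) (Y : ℕ → Ω → Fin p → ℝ)
    (T : ℕ) (ω : Ω) : Matrix (Fin p) (Fin p) ℝ :=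
  (1 / (T : ℝ)) • ∑ t ∈ Finset.Icc 1 T, Matrix.vecMulVec (X A Y T t ω) (X A Y T t ω)

/-- The estimator of `M(u)`. -/
def MHat (A : ℝ → Matrix (Fin p) (Fin p) ℝ) (Y : ℕ → Ω → Fin p → ℝ) (K : ℝ → ℝ)
    (T : ℕ) (h u : ℝ) (ω : Ω) : Matrix (Fin p) (Fin p) ℝ :=
  sqHat A Y K T h u ω - sqMeanHat A Y T ω

/-- The square root `S^{1/2}` of a real symmetric matrix `S`, by applying `x ↦ √(max x 0)` to the
eigenvalues; for positive semidefinite `S` it is the positive semidefinite square root. -/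
def root (S : Matrix (Fin p) (Fin p) ℝ) : Matrix (Fin p) (Fin p) ℝ := cfc Real.sqrt S

/-- The estimator of the matrix `A(u)`, the square root of the estimator of `A²(u)`. -/
def rootHat (A : ℝ → Matrix (Fin p) (Fin p) ℝ) (Y : ℕ → Ω → Fin p → ℝ) (K : ℝ → ℝ)
    (T : ℕ) (h u : ℝ) (ω : Ω) : Matrix (Fin p) (Fin p) ℝ :=
  root (sqHat A Y K T h u ω)

/-- Convergence in probability, as `T → ∞`, of random matrices to a constant matrix
(for matrices of a fixed size this is convergence in probability of every entry). -/
def TendstoInProb [MeasurableSpace Ω] (P : Measure Ω) (B : ℕ → Ω → Matrix (Fin p) (Fin p) ℝ)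
    (C : Matrix (Fin p) (Fin p) ℝ) : Prop :=
  ∀ i j, TendstoInMeasure P (fun T ω => B T ω i j) atTop (fun _ => C i j)

end Model

/-- Independent centred normal variables `w (i, j)`, with variance `1` if `i = j` and variance
`1 / m` if `i ≠ j`. -/
abbrev gaussianEntries (p : ℕ) (m : ℝ) : Measure (Fin p × Fin p → ℝ) :=
  Measure.pi fun ij => gaussianReal 0 (if ij.1 = ij.2 then 1 else (1 / m).toNNReal)

/-- The symmetric matrix whose entries on and above the diagonal are those of `w`. With `w`
distributed according to `gaussianEntries p μ₄` this is the random matrix `𝒵_p`. -/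
def symmOf {p : ℕ} (w : Fin p × Fin p → ℝ) : Fin p → Fin p → ℝ :=
  fun i j => w (min i j, max i j)

end VCModel

end

/-! Replacing `A` by `S A` turns every `X_t X_t'`, hence also the error `M̂ - M`, into its
congruence by `S`. With `S = A(u)⁻¹` the limit theorem reduces to the case `A(u) = 1`.

The entries of `X_t X_t'` are linear combinations of the centred products `y_k y_l - δ_kl`, plus the
entries of `A²(t/T)`. Freezing the coefficients at `u` splits the error into three parts
(`MHat_sub_M_apply`): * a kernel-weighted sum of the centred products themselves, the only part that
survives in the limit; * a stochastic remainder whose weights, multiplied by `√(Th)`, have squares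
summing to `o(1)`, so that Chebyshev's inequality removes it (`tendstoInMeasure_centeredSum`,
`IsKernel.tendsto_sum_remainderWeight_sq`); * a deterministic bias `O(h + 1/(Th)) + O(1/T)`, which
stays negligible after multiplication by `√(Th)` because `Th³ → 0`, `h → 0` and `Th → ∞`
(`tendsto_sqrt_mul_bias`).

The leading part is handled by characteristic functions (`tendsto_prod_charFun`): its weights are
uniformly small and their squares sum to `1` in the limit. Centred products of distinct unordered
pairs are orthogonal, with second moment `μ₄` on the diagonal and `1` off it, which after division
by `μ₄` gives the covariance of `𝒵_p`.

Consistency of `Â²(u)` needs only Chebyshev and the bias bound. Everything else follows by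
continuous mapping: the functional calculus is continuous on symmetric matrices, inversion is
continuous at invertible ones, and `Q` comes from the polar decomposition of `A(u)`. -/

noncomputable section

namespace VCModel

/-! ### Riemann sums and bounded variation -/

/-- Right Riemann sums over a uniform grid of a function of bounded variation. -/
theorem abs_riemannSum_sub_integral_le {f : ℝ → ℝ} (hf : BoundedVariationOn f (Icc 0 1))
    (hfi : IntervalIntegrable f volume 0 1) {T : ℕ} (hT : 0 < T) :
    |(1 / (T : ℝ)) * ∑ t ∈ Finset.Icc 1 T, f (t / T) - ∫ v in (0 : ℝ)..1, f v| ≤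
      (eVariationOn f (Icc 0 1)).toReal / T := by
  have hT' : (0 : ℝ) < T := by exact_mod_cast hT
  set I : ℕ → ℝ := fun n => n / T with hI
  have hImono : Monotone I := fun a b hab => by
    simp only [hI]; gcongr
  have hI0 : I 0 = 0 := by simp [hI]
  have hIT : I T = 1 := by simp [hI, hT'.ne']
  have hsub : ∀ n < T, Icc (I n) (I (n + 1)) ⊆ Icc 0 1 := fun n hn => by
    apply Icc_subset_Icc
    · rw [← hI0]; exact hImono (Nat.zero_le n)
    · rw [← hIT]; exact hImono hn
  have hint : ∀ n < T, IntervalIntegrable f volume (I n) (I (n + 1)) := fun n hn => by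
    apply hfi.mono_set
    rw [uIcc_of_le (hImono (Nat.le_succ n)), uIcc_of_le zero_le_one]
    exact hsub n hn
  have hVsum : ∑ n ∈ Finset.range T, (eVariationOn f (Icc (I n) (I (n + 1)))).toReal =
      (eVariationOn f (Icc 0 1)).toReal := by
    rw [← ENNReal.toReal_sum, eVariationOn.sum' f hImono, hI0, hIT]
    intro n hn
    exact hf.mono (hsub n (Finset.mem_range.1 hn))
  have hIsum : ∑ n ∈ Finset.range T, ∫ v in (I n)..(I (n + 1)), f v = ∫ v in (0 : ℝ)..1, f v := by
    rw [intervalIntegral.sum_integral_adjacent_intervals hint, hI0, hIT]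
  have hRsum : ∑ t ∈ Finset.Icc 1 T, f (t / T) = ∑ n ∈ Finset.range T, f (I (n + 1)) := by
    rw [Finset.range_eq_Ico, Finset.sum_Ico_add' (fun n => f (I n)) 0 T 1]
    rfl
  have hcell : ∀ n, I (n + 1) - I n = 1 / T := fun n => by
    simp only [hI]; push_cast; ring
  rw [hRsum, ← hIsum, Finset.mul_sum, ← Finset.sum_sub_distrib, ← hVsum, Finset.sum_div]
  -- On a cell of length `1/T` the integrand differs from its right-end value by at most the
  -- variation over that cell; these variations add up to the total.
  refine (Finset.abs_sum_le_sum_abs _ _).trans (Finset.sum_le_sum fun n hn => ?_)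
  have hn := Finset.mem_range.1 hn
  have hconst : 1 / (T : ℝ) * f (I (n + 1)) = ∫ v in (I n)..(I (n + 1)), f (I (n + 1)) := by
    rw [intervalIntegral.integral_const, hcell, smul_eq_mul]
  rw [hconst, ← intervalIntegral.integral_sub (by simp) (hint n hn)]
  have hle := hImono (Nat.le_succ n)
  have := intervalIntegral.norm_integral_le_of_norm_le_const (a := I n) (b := I (n + 1))
    (f := fun v => f (I (n + 1)) - f v)
    (C := (eVariationOn f (Icc (I n) (I (n + 1)))).toReal) (fun v hv => by
      rw [uIoc_of_le hle] at hv
      have := (hf.mono (hsub n hn)).dist_le (right_mem_Icc.2 hle) ⟨hv.1.le, hv.2⟩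
      rwa [Real.dist_eq] at this)
  rw [hcell, abs_of_pos (by positivity)] at this
  rw [Real.norm_eq_abs] at this
  rw [div_eq_mul_one_div]
  exact this

/-- An affine change of variable does not raise the variation. The bound is free of `c` and `u`, so
Riemann sum errors are uniform in the bandwidth. -/
theorem eVariationOn_comp_mul_sub_le (G : ℝ → ℝ) (c u : ℝ)
    (hc : 0 ≤ c) (s : Set ℝ) :
    eVariationOn (fun v => G (c * (u - v))) s ≤ eVariationOn G univ := by
  refine eVariationOn.comp_le_of_antitoneOn G (fun v => c * (u - v)) ?_ (fun _ _ => mem_univ _)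
  intro a _ b _ hab
  simp only
  gcongr

theorem integral_comp_mul_sub {G : ℝ → ℝ} {h : ℝ} (hh : 0 < h) (u : ℝ) :
    ∫ v in (0 : ℝ)..1, G (h⁻¹ * (u - v)) = h * ∫ w in (h⁻¹ * (u - 1))..(h⁻¹ * u), G w := by
  have := intervalIntegral.integral_comp_sub_left (a := 0) (b := 1) (fun v => G (h⁻¹ * v)) u
  rw [this, sub_zero, intervalIntegral.integral_comp_mul_left _ (inv_ne_zero hh.ne')]
  simp

theorem integrable_comp_mul_sub {G : ℝ → ℝ} (hG : Integrable G) {h : ℝ} (hh : 0 < h) (u : ℝ) :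
    Integrable fun v => G (h⁻¹ * (u - v)) :=
  (hG.comp_mul_left' (inv_ne_zero hh.ne')).comp_sub_left u

/-- Kernel-weighted Riemann sums of an integrable function of bounded variation. -/
theorem abs_kernelSum_sub_integral_le {G : ℝ → ℝ} (hG : BoundedVariationOn G univ)
    (hGi : Integrable G) {T : ℕ} (hT : 0 < T) {h : ℝ} (hh : 0 < h) (u : ℝ) :
    |(1 / (T * h)) * ∑ t ∈ Finset.Icc 1 T, G (h⁻¹ * (u - t / T)) -
        ∫ w in (h⁻¹ * (u - 1))..(h⁻¹ * u), G w| ≤ (eVariationOn G univ).toReal / (T * h) := by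
  have hT' : (0 : ℝ) < T := by exact_mod_cast hT
  have hle := eVariationOn_comp_mul_sub_le G h⁻¹ u (inv_nonneg.2 hh.le) (Icc 0 1)
  have key := abs_riemannSum_sub_integral_le (f := fun v => G (h⁻¹ * (u - v)))
    (ne_top_of_le_ne_top hG hle) (integrable_comp_mul_sub hGi hh u).intervalIntegrable hT
  rw [integral_comp_mul_sub hh] at key
  have key2 := key.trans (div_le_div_of_nonneg_right (ENNReal.toReal_mono hG hle) hT'.le)
  have : (1 / (T * h)) * ∑ t ∈ Finset.Icc 1 T, G (h⁻¹ * (u - t / T)) -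
      ∫ w in (h⁻¹ * (u - 1))..(h⁻¹ * u), G w = h⁻¹ * ((1 / (T : ℝ)) *
        ∑ t ∈ Finset.Icc 1 T, G (h⁻¹ * (u - t / T)) -
        h * ∫ w in (h⁻¹ * (u - 1))..(h⁻¹ * u), G w) := by
    field_simp
  rw [this, abs_mul, abs_of_pos (inv_pos.2 hh), ← div_div, div_right_comm]
  calc _ ≤ h⁻¹ * ((eVariationOn G univ).toReal / T) := by gcongr
    _ = _ := by field_simp

/-- The mass of a function outside a large window, in terms of its first absolute moment. -/
theorem abs_integral_sub_integral_window_le {G : ℝ → ℝ} (hGi : Integrable G)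
    (hm : Integrable fun v => v * G v) {h : ℝ} (hh : 0 < h) {u : ℝ} (hu : u ∈ Ioo (0 : ℝ) 1) :
    |(∫ w in (h⁻¹ * (u - 1))..(h⁻¹ * u), G w) - ∫ w, G w| ≤
      h / min u (1 - u) * ∫ w, |w * G w| := by
  obtain ⟨hu0, hu1⟩ := hu
  have hc : 0 < min u (1 - u) := lt_min hu0 (by linarith)
  have hle : h⁻¹ * (u - 1) ≤ h⁻¹ * u := by gcongr; linarith
  rw [intervalIntegral.integral_of_le hle,
    ← integral_add_compl (measurableSet_Ioc (a := h⁻¹ * (u - 1)) (b := h⁻¹ * u)) hGi,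
    sub_add_cancel_left, abs_neg, ← integral_const_mul]
  refine (abs_integral_le_integral_abs).trans ?_
  calc ∫ w in (Ioc (h⁻¹ * (u - 1)) (h⁻¹ * u))ᶜ, |G w|
      ≤ ∫ w in (Ioc (h⁻¹ * (u - 1)) (h⁻¹ * u))ᶜ, h / min u (1 - u) * |w * G w| := by
        refine setIntegral_mono_on hGi.abs.integrableOn
          (hm.abs.const_mul _).integrableOn measurableSet_Ioc.compl fun w hw => ?_
        -- Outside the window `h|w|` is at least the distance from `u` to the ends of `[0,1]`, so
        -- Markov's inequality applies with the first moment.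
        have hw' : min u (1 - u) ≤ h * |w| := by
          rw [mem_compl_iff, mem_Ioc, not_and_or, not_lt, not_le] at hw
          rcases hw with hw | hw
          · rw [inv_mul_eq_div, le_div_iff₀ hh] at hw
            have := neg_le_abs w
            have : h * -w ≤ h * |w| := by gcongr
            exact (min_le_right _ _).trans (by linarith)
          · rw [inv_mul_eq_div, div_lt_iff₀ hh] at hw
            have := le_abs_self w
            have : h * w ≤ h * |w| := by gcongr
            exact (min_le_left _ _).trans (by linarith)
        rw [abs_mul, div_mul_eq_mul_div, le_div_iff₀ hc, ← mul_assoc, mul_comm |G w|]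
        gcongr
    _ ≤ ∫ w, h / min u (1 - u) * |w * G w| :=
        setIntegral_le_integral (hm.abs.const_mul _)
          (Eventually.of_forall fun w => by positivity)

/-! ### Kernel sums -/

section Kernel

variable {K : ℝ → ℝ}

theorem IsKernel.exists_bound (hK : IsKernel K) : ∃ C, 0 ≤ C ∧ ∀ v, |K v| ≤ C := by
  refine ⟨(eVariationOn K univ).toReal + |K 0|, by positivity, fun v => ?_⟩
  have := hK.boundedVariation.dist_le (mem_univ v) (mem_univ 0)
  rw [Real.dist_eq] at this
  have h2 := abs_sub_abs_le_abs_sub (K v) (K 0)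
  linarith

theorem IsKernel.integrable_sq (hK : IsKernel K) : Integrable fun v => K v ^ 2 := by
  obtain ⟨C, -, hC⟩ := hK.exists_bound
  simpa [pow_two] using hK.integrable.bdd_mul (c := C) hK.integrable.aestronglyMeasurable
    (Eventually.of_forall hC)

theorem IsKernel.kernelNorm_pos (hK : IsKernel K) : 0 < kernelNorm K := by
  rw [kernelNorm, Real.sqrt_pos, integral_pos_iff_support_of_nonneg (fun v => sq_nonneg _)
    hK.integrable_sq]
  rw [pos_iff_ne_zero]
  intro h0
  have : K =ᵐ[volume] 0 := by
    rw [Filter.EventuallyEq, ae_iff]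
    convert h0 using 2
    ext v
    simp
  have := integral_congr_ae this
  rw [hK.integral_eq_one] at this
  simp at this

theorem IsKernel.kernelNorm_sq (K : ℝ → ℝ) : kernelNorm K ^ 2 = ∫ v, K v ^ 2 :=
  Real.sq_sqrt (integral_nonneg fun _ => sq_nonneg _)

theorem IsKernel.tendsto_kernelSum_sq (hK : IsKernel K) {u : ℝ} (hu : u ∈ Ioo (0 : ℝ) 1)
    {h : ℕ → ℝ} (hpos : ∀ᶠ T in atTop, 0 < h T) (h_zero : Tendsto h atTop (𝓝 0))
    (h_lower : Tendsto (fun T : ℕ => (T : ℝ) * h T) atTop atTop) :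
    Tendsto (fun T : ℕ => (1 / (T * h T)) *
      ∑ t ∈ Finset.Icc 1 T, K ((h T)⁻¹ * (u - t / T)) ^ 2) atTop (𝓝 (∫ v, K v ^ 2)) := by
  have hbv : BoundedVariationOn (fun v => K v ^ 2) univ := by
    simpa [pow_two] using hK.boundedVariation.fun_mul hK.boundedVariation
  have hinv : Tendsto (fun T => (h T)⁻¹) atTop atTop :=
    (tendsto_nhdsWithin_iff.2 ⟨h_zero, hpos⟩).inv_tendsto_nhdsGT_zero
  have hint : Tendsto (fun T => ∫ w in ((h T)⁻¹ * (u - 1))..((h T)⁻¹ * u), K w ^ 2) atTop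
      (𝓝 (∫ v, K v ^ 2)) :=
    intervalIntegral_tendsto_integral hK.integrable_sq
      (hinv.atTop_mul_const_of_neg (by linarith [hu.2])) (hinv.atTop_mul_const hu.1)
  have hdiff : Tendsto (fun T : ℕ => (1 / (T * h T)) *
      ∑ t ∈ Finset.Icc 1 T, K ((h T)⁻¹ * (u - t / T)) ^ 2 -
      ∫ w in ((h T)⁻¹ * (u - 1))..((h T)⁻¹ * u), K w ^ 2) atTop (𝓝 0) := by
    refine squeeze_zero_norm' ?_ (h_lower.const_div_atTop
      (eVariationOn (fun v => K v ^ 2) univ).toReal)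
    filter_upwards [hpos, eventually_gt_atTop 0] with T hT hT0
    exact abs_kernelSum_sub_integral_le hbv hK.integrable_sq hT0 hT u
  simpa using hdiff.add hint

/-- The Riemann sum error gives `1/(Th)`; the kernel mass that falls outside the window gives `h`,
through the first moment. -/
theorem IsKernel.exists_abs_kernelSum_sub_one_le (hK : IsKernel K) {u : ℝ}
    (hu : u ∈ Ioo (0 : ℝ) 1) :
    ∃ C, 0 ≤ C ∧ ∀ T : ℕ, 0 < T → ∀ h : ℝ, 0 < h →
      |(1 / (T * h)) * ∑ t ∈ Finset.Icc 1 T, K (h⁻¹ * (u - t / T)) - 1| ≤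
        C * (h + 1 / (T * h)) := by
  have hc : 0 < min u (1 - u) := lt_min hu.1 (by linarith [hu.2])
  have hm0 : 0 ≤ ∫ w, |w * K w| := integral_nonneg fun _ => abs_nonneg _
  refine ⟨max (eVariationOn K univ).toReal ((∫ w, |w * K w|) / min u (1 - u)), by positivity,
    fun T hT h hh => ?_⟩
  have hT' : (0 : ℝ) < T := by exact_mod_cast hT
  have h1 := abs_kernelSum_sub_integral_le hK.boundedVariation hK.integrable hT hh u
  have h2 := abs_integral_sub_integral_window_le hK.integrable hK.integrable_moment hh hu
  rw [hK.integral_eq_one] at h2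
  refine (abs_sub_le _ _ _).trans ((add_le_add h1 h2).trans ?_)
  rw [mul_add, add_comm]
  refine add_le_add ?_ ?_
  · rw [div_mul_eq_mul_div, mul_div_assoc, mul_comm]
    gcongr
    exact le_max_right _ _
  · rw [div_eq_mul_one_div]
    gcongr
    exact le_max_left _ _

theorem boundedVariationOn_abs_sub (u : ℝ) : BoundedVariationOn (fun v : ℝ => |v - u|) (Icc 0 1) := by
  have hlip : LipschitzWith 1 fun v : ℝ => |v - u| :=
    LipschitzWith.of_dist_le_mul fun a b => by
      simp only [Real.dist_eq, NNReal.coe_one, one_mul]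
      exact (abs_abs_sub_abs_le _ _).trans (by simp)
  have := hlip.locallyBoundedVariationOn (Icc (0 : ℝ) 1) 0 1 (by simp) (by simp)
  simpa using this

theorem eVariationOn_kernel_mul_abs_sub_le {G : ℝ → ℝ} {B : ℝ} (hB : ∀ v, |G v| ≤ B)
    {u : ℝ} (hu : u ∈ Ioo (0 : ℝ) 1) {c : ℝ} (hc : 0 ≤ c) :
    eVariationOn (fun v => G (c * (u - v)) * |v - u|) (Icc 0 1) ≤
      ENNReal.ofReal B * eVariationOn (fun v : ℝ => |v - u|) (Icc 0 1) +
        eVariationOn G univ := by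
  refine (eVariationOn_fun_mul_le (f := fun v => G (c * (u - v))) (g := fun v => |v - u|)
    (C := ENNReal.ofReal B) (D := 1) (fun v _ => ?_) fun v hv => ?_).trans ?_
  · rw [Real.enorm_eq_ofReal_abs]
    exact ENNReal.ofReal_le_ofReal (hB _)
  · rw [Real.enorm_eq_ofReal_abs, abs_abs, ← ENNReal.ofReal_one]
    apply ENNReal.ofReal_le_ofReal
    rw [abs_le]
    constructor <;> linarith [hv.1, hv.2, hu.1, hu.2]
  · rw [one_mul]
    exact add_le_add le_rfl (eVariationOn_comp_mul_sub_le G c u hc (Icc 0 1))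

/-- Substituting `w = (u - v)/h` yields one factor `h` from `dv` and another from `|v - u| = h|w|`.
-/
theorem integral_kernel_mul_abs_sub_le {G : ℝ → ℝ} (hm : Integrable fun w => |w| * G w)
    (h0 : ∀ w, 0 ≤ G w) (u : ℝ) {h : ℝ} (hh : 0 < h) :
    Integrable (fun v => G (h⁻¹ * (u - v)) * |v - u|) ∧
    ∫ v in (0 : ℝ)..1, G (h⁻¹ * (u - v)) * |v - u| ≤ h * (h * ∫ w, |w| * G w) := by
  have hfeq : (fun v => G (h⁻¹ * (u - v)) * |v - u|) =
      fun v => h * (|h⁻¹ * (u - v)| * G (h⁻¹ * (u - v))) := by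
    ext v
    rw [abs_mul, abs_of_pos (inv_pos.2 hh), abs_sub_comm v u]
    field_simp
  rw [hfeq]
  refine ⟨(integrable_comp_mul_sub hm hh u).const_mul h, ?_⟩
  rw [intervalIntegral.integral_const_mul,
    integral_comp_mul_sub (G := fun w => |w| * G w) hh]
  have hle : h⁻¹ * (u - 1) ≤ h⁻¹ * u := by gcongr; linarith
  rw [intervalIntegral.integral_of_le hle]
  refine mul_le_mul_of_nonneg_left (mul_le_mul_of_nonneg_left ?_ hh.le) hh.le
  exact setIntegral_le_integral hm
    (Eventually.of_forall fun w => mul_nonneg (abs_nonneg _) (h0 w))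

/-- This serves twice: multiplied by a Lipschitz constant it bounds the smoothing bias, and it also
bounds the variance of the stochastic remainder. -/
theorem IsKernel.exists_kernelSum_abs_mul_le (hK : IsKernel K) {u : ℝ}
    (hu : u ∈ Ioo (0 : ℝ) 1) :
    ∃ C, 0 ≤ C ∧ ∀ T : ℕ, 0 < T → ∀ h : ℝ, 0 < h →
      (1 / (T * h)) * ∑ t ∈ Finset.Icc 1 T, |K (h⁻¹ * (u - t / T))| * |(t : ℝ) / T - u| ≤
        C * (h + 1 / (T * h)) := by
  obtain ⟨B, hB0, hB⟩ := hK.exists_bound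
  have habs : BoundedVariationOn (fun v => |K v|) univ :=
    LipschitzWith.comp_boundedVariationOn (f := fun x : ℝ => |x|) (C := 1)
      lipschitzWith_one_norm hK.boundedVariation
  have hm : Integrable fun w => |w| * |K w| := by
    simpa only [abs_mul] using hK.integrable_moment.abs
  obtain ⟨W, hW⟩ : ∃ W, W = ENNReal.ofReal B * eVariationOn (fun v : ℝ => |v - u|) (Icc 0 1) +
    eVariationOn (fun v => |K v|) univ := ⟨_, rfl⟩
  have hWtop : W ≠ ⊤ := by
    rw [hW]
    exact ENNReal.add_ne_top.2 ⟨ENNReal.mul_ne_top ENNReal.ofReal_ne_top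
      (boundedVariationOn_abs_sub u), habs⟩
  obtain ⟨m, hm'⟩ : ∃ m, ∫ w, |w| * |K w| = m := ⟨_, rfl⟩
  have hm0 : 0 ≤ m := by
    rw [← hm']
    exact integral_nonneg fun _ => mul_nonneg (abs_nonneg _) (abs_nonneg _)
  have hW0 : 0 ≤ W.toReal := ENNReal.toReal_nonneg
  refine ⟨max W.toReal m, by positivity, fun T hT h hh => ?_⟩
  have hT' : (0 : ℝ) < T := by exact_mod_cast hT
  have hvar := eVariationOn_kernel_mul_abs_sub_le (G := fun v => |K v|) (B := B)
    (fun v => by rw [abs_abs]; exact hB v) hu (inv_nonneg.2 hh.le)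
  rw [← hW] at hvar
  obtain ⟨hfi, hint⟩ := integral_kernel_mul_abs_sub_le (G := fun v => |K v|) hm
    (fun w => abs_nonneg _) u hh
  rw [hm'] at hint
  have key := (abs_le.1 (abs_riemannSum_sub_integral_le (ne_top_of_le_ne_top hWtop hvar)
    hfi.intervalIntegrable hT)).2
  have key2 : (1 / (T : ℝ)) * ∑ t ∈ Finset.Icc 1 T, |K (h⁻¹ * (u - t / T))| * |(t : ℝ) / T - u| ≤
      W.toReal / T + h * (h * m) := by
    have := div_le_div_of_nonneg_right (ENNReal.toReal_mono hWtop hvar) hT'.le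
    linarith
  calc (1 / (T * h)) * ∑ t ∈ Finset.Icc 1 T, |K (h⁻¹ * (u - t / T))| * |(t : ℝ) / T - u|
      = h⁻¹ * ((1 / (T : ℝ)) *
          ∑ t ∈ Finset.Icc 1 T, |K (h⁻¹ * (u - t / T))| * |(t : ℝ) / T - u|) := by
        rw [← mul_assoc]; congr 1; field_simp
    _ ≤ h⁻¹ * (W.toReal / T + h * (h * m)) := by gcongr
    _ = m * h + W.toReal * (1 / (T * h)) := by field_simp; ring
    _ ≤ max W.toReal m * h + max W.toReal m * (1 / (T * h)) :=
      add_le_add (mul_le_mul_of_nonneg_right (le_max_right _ _) hh.le)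
        (mul_le_mul_of_nonneg_right (le_max_left _ _) (by positivity))
    _ = _ := by rw [mul_add]

end Kernel

/-! ### Independence of the observations -/

/-- If the rows of an array are made of independent variables, all of law `ν`, then the rows are
independent. -/
theorem iIndepFun_rows {ι κ Ω : Type*} [Countable ι] [Countable κ] [MeasurableSpace Ω]
    {P : Measure Ω} [IsProbabilityMeasure P]
    {ν : Measure ℝ} [IsProbabilityMeasure ν] {Y : ι → Ω → κ → ℝ}
    (hY_law : ∀ t i, HasLaw (fun ω => Y t ω i) ν P)
    (hY_indep : iIndepFun (fun (q : ι × κ) ω => Y q.1 ω q.2) P) : iIndepFun Y P := by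
  have hm : ∀ t, AEMeasurable (Y t) P := fun t =>
    aemeasurable_pi_iff.2 fun i => (hY_law t i).aemeasurable
  have hrow : ∀ t, P.map (Y t) = Measure.infinitePi fun _ : κ => ν := fun t =>
    (iIndepFun.hasLaw_infinitePi (X := fun i ω => Y t ω i) (hY_law t)
      (hY_indep.precomp (g := fun i => (t, i)) fun a b hab => by simpa using hab) (hm t)).map_eq
  rw [iIndepFun_iff_map_fun_eq_infinitePi_map₀ (aemeasurable_pi_iff.2 hm)]
  have hall := (iIndepFun.hasLaw_infinitePi (X := fun (q : ι × κ) ω => Y q.1 ω q.2)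
    (fun q => hY_law q.1 q.2) hY_indep
    (aemeasurable_pi_iff.2 fun q => (hY_law q.1 q.2).aemeasurable)).map_eq
  simp_rw [hrow]
  have hcurry := AEMeasurable.map_map_of_aemeasurable (μ := P)
    (f := fun ω (q : ι × κ) => Y q.1 ω q.2) (g := MeasurableEquiv.curry ι κ ℝ)
    (MeasurableEquiv.measurable _).aemeasurable
    (aemeasurable_pi_iff.2 fun q => (hY_law q.1 q.2).aemeasurable)
  -- Currying identifies the product over all index pairs with the product over rows of the row
  -- laws.
  rw [← Measure.infinitePi_map_curry (fun _ _ => ν), ← hall, hcurry]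
  rfl

/-! ### Moments of centred products and Chebyshev's inequality -/

section Moments

variable {p : ℕ}

/-- The centred product of two coordinates of a vector with independent standardized entries. -/
def centeredProd (k l : Fin p) (y : Fin p → ℝ) : ℝ := y k * y l - if k = l then 1 else 0

/-- The factors of `centeredProd` as a product over all coordinates. -/
def centeredFactor (k l m : Fin p) (x : ℝ) : ℝ :=
  if k = l then (if m = k then x ^ 2 - 1 else 1) else (if m = k ∨ m = l then x else 1)

theorem centeredProd_comm (k l : Fin p) : centeredProd k l = centeredProd l k := by
  ext y
  simp only [centeredProd, mul_comm, eq_comm]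

/-- The factorisation over coordinates lets Fubini reduce every moment to one-dimensional integrals.
-/
theorem centeredProd_eq_prod (k l : Fin p) (y : Fin p → ℝ) :
    centeredProd k l y = ∏ m, centeredFactor k l m (y m) := by
  by_cases hkl : k = l
  · subst hkl
    simp [centeredProd, centeredFactor, Finset.prod_ite_eq', pow_two]
  · rw [Fintype.prod_eq_mul k l hkl]
    · simp [centeredProd, centeredFactor, hkl]
    · rintro m ⟨h1, h2⟩
      simp [centeredFactor, hkl, h1, h2]

theorem measurable_centeredProd (k l : Fin p) : Measurable (centeredProd k l) := by
  unfold centeredProd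
  fun_prop

variable {ν : Measure ℝ} {Ω : Type*} [MeasurableSpace Ω] {P : Measure Ω}
  {Y : ℕ → Ω → Fin p → ℝ}

theorem memLp_two_sq (hν_four : MemLp (fun y : ℝ => y) 4 ν) : MemLp (fun y : ℝ => y ^ 2) 2 ν := by
  rw [memLp_two_iff_integrable_sq (by fun_prop)]
  have := hν_four.integrable_norm_pow (p := 4) (by norm_num)
  refine this.congr (Eventually.of_forall fun y => ?_)
  simp only [Real.norm_eq_abs]
  rw [Even.pow_abs (by decide)]
  ring

theorem hasLaw_row (hY_law : ∀ t i, HasLaw (fun ω => Y t ω i) ν P)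
    (hY_indep : iIndepFun (fun (q : ℕ × Fin p) ω => Y q.1 ω q.2) P) (t : ℕ) :
    HasLaw (Y t) (Measure.pi fun _ => ν) P :=
  iIndepFun.hasLaw_pi (X := fun i ω => Y t ω i) (hY_law t)
      (hY_indep.precomp (g := fun i => (t, i)) fun a b hab => by simpa using hab)

theorem aemeasurable_centeredSum (hlaw : ∀ t, HasLaw (Y t) (Measure.pi fun _ => ν) P)
    (c : ℕ → Fin p × Fin p → ℝ) (s : Finset ℕ) :
    AEMeasurable (fun ω => ∑ t ∈ s, ∑ q, c t q * centeredProd q.1 q.2 (Y t ω)) P :=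
  Finset.aemeasurable_fun_sum _ fun t _ => Finset.aemeasurable_fun_sum _ fun q _ =>
    ((measurable_centeredProd q.1 q.2).comp_aemeasurable (hlaw t).aemeasurable).const_mul _

variable [IsProbabilityMeasure ν]

theorem memLp_centeredFactor (hν_four : MemLp (fun y : ℝ => y) 4 ν) (k l m : Fin p) :
    MemLp (centeredFactor k l m) 2 ν := by
  unfold centeredFactor
  split_ifs
  · exact (memLp_two_sq hν_four).sub (memLp_const 1)
  · exact memLp_const 1
  · exact hν_four.mono_exponent (by norm_num)
  · exact memLp_const 1

theorem integrable_centeredProd_mul (hν_four : MemLp (fun y : ℝ => y) 4 ν) (k l k' l' : Fin p) :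
    Integrable (fun y => centeredProd k l y * centeredProd k' l' y)
      (Measure.pi fun _ : Fin p => ν) := by
  simp_rw [centeredProd_eq_prod, ← Finset.prod_mul_distrib]
  exact Integrable.fintype_prod
    (f := fun m x => centeredFactor k l m x * centeredFactor k' l' m x)
    fun m => (memLp_centeredFactor hν_four k l m).integrable_mul
      (memLp_centeredFactor hν_four k' l' m)

theorem memLp_centeredProd (hν_four : MemLp (fun y : ℝ => y) 4 ν) (k l : Fin p) :
    MemLp (centeredProd k l) 2 (Measure.pi fun _ : Fin p => ν) := by
  rw [memLp_two_iff_integrable_sq (measurable_centeredProd k l).aestronglyMeasurable]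
  simpa only [pow_two] using integrable_centeredProd_mul hν_four k l k l

theorem integral_centeredProd_mul (k l k' l' : Fin p) :
    ∫ y, centeredProd k l y * centeredProd k' l' y ∂(Measure.pi fun _ : Fin p => ν) =
      ∏ m, ∫ x, centeredFactor k l m x * centeredFactor k' l' m x ∂ν := by
  simp_rw [centeredProd_eq_prod, ← Finset.prod_mul_distrib]
  exact integral_fintype_prod_eq_prod
    (fun m x => centeredFactor k l m x * centeredFactor k' l' m x)

theorem integral_sq_sub_one (hν_four : MemLp (fun y : ℝ => y) 4 ν) (hν_var : ∫ y, y ^ 2 ∂ν = 1) :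
    ∫ y, (y ^ 2 - 1) ∂ν = 0 := by
  rw [integral_sub ((memLp_two_sq hν_four).integrable (by norm_num)) (by simp), hν_var]
  simp

theorem integral_centeredProd (hν_four : MemLp (fun y : ℝ => y) 4 ν)
    (hν_mean : ∫ y, y ∂ν = 0) (hν_var : ∫ y, y ^ 2 ∂ν = 1) (k l : Fin p) :
    ∫ y, centeredProd k l y ∂(Measure.pi fun _ : Fin p => ν) = 0 := by
  simp_rw [centeredProd_eq_prod]
  rw [integral_fintype_prod_eq_prod (fun m x => centeredFactor k l m x)]
  apply Finset.prod_eq_zero (Finset.mem_univ k)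
  by_cases hkl : k = l
  · simpa [centeredFactor, hkl] using integral_sq_sub_one hν_four hν_var
  · simpa [centeredFactor, hkl] using hν_mean

/-- Two distinct ordered pairs are distinct as sets, so some index lies in exactly one of them. The
factor at that index is `x` or `x² - 1`, of mean zero. -/
theorem integral_centeredProd_mul_of_ne (hν_four : MemLp (fun y : ℝ => y) 4 ν)
    (hν_mean : ∫ y, y ∂ν = 0) (hν_var : ∫ y, y ^ 2 ∂ν = 1) {k l k' l' : Fin p}
    (hkl : k ≤ l) (hkl' : k' ≤ l') (hne : (k, l) ≠ (k', l')) :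
    ∫ y, centeredProd k l y * centeredProd k' l' y ∂(Measure.pi fun _ : Fin p => ν) = 0 := by
  have h0 := integral_sq_sub_one hν_four hν_var
  have hone : ∀ a b m : Fin p, m ≠ a → m ≠ b → centeredFactor a b m = fun _ => 1 := by
    intro a b m ha hb
    ext x
    simp [centeredFactor, ha, hb]
  have hzero : ∀ a b m : Fin p, m = a ∨ m = b → ∫ x, centeredFactor a b m x ∂ν = 0 := by
    intro a b m hm
    by_cases hab : a = b
    · have : m = b := by rcases hm with rfl | rfl <;> simp [hab]
      simpa [centeredFactor, hab, this] using h0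
    · simpa [centeredFactor, hab, hm] using hν_mean
  rw [integral_centeredProd_mul]
  have hex : ∃ m, ((m = k ∨ m = l) ∧ m ≠ k' ∧ m ≠ l') ∨ ((m = k' ∨ m = l') ∧ m ≠ k ∧ m ≠ l) := by
    by_contra! hcon
    apply hne
    have a1 := (hcon k).1 (Or.inl rfl)
    have a2 := (hcon l).1 (Or.inr rfl)
    have a3 := (hcon k').2 (Or.inl rfl)
    have a4 := (hcon l').2 (Or.inr rfl)
    rw [Prod.mk.injEq]
    by_cases c1 : k = k' <;> by_cases c2 : l = l' <;> grind
  obtain ⟨m, ⟨hm, h1, h2⟩ | ⟨hm, h1, h2⟩⟩ := hex <;> apply Finset.prod_eq_zero (Finset.mem_univ m)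
  · simpa [hone k' l' m h1 h2] using hzero k l m hm
  · simpa [hone k l m h1 h2] using hzero k' l' m hm

theorem integral_centeredProd_sq (hν_var : ∫ y, y ^ 2 ∂ν = 1) (k l : Fin p) :
    ∫ y, centeredProd k l y * centeredProd k l y ∂(Measure.pi fun _ : Fin p => ν) =
      if k = l then mu4 ν else 1 := by
  rw [integral_centeredProd_mul]
  by_cases hkl : k = l
  · subst hkl
    rw [Fintype.prod_eq_single k]
    · simp [centeredFactor, mu4, pow_two]
    · intro m hm
      simp [centeredFactor, hm]
  · rw [Finset.prod_eq_one]
    · simp [hkl]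
    intro m _
    by_cases hm : m = k ∨ m = l
    · simpa [centeredFactor, hkl, hm, pow_two] using hν_var
    · simp [centeredFactor, hkl, hm]

/-- The second moment of a linear combination of centred products. -/
theorem integral_sum_centeredProd_sq_le (hν_four : MemLp (fun y : ℝ => y) 4 ν)
    (hν_var : ∫ y, y ^ 2 ∂ν = 1) (c : Fin p × Fin p → ℝ) :
    ∫ y, (∑ q, c q * centeredProd q.1 q.2 y) ^ 2 ∂(Measure.pi fun _ : Fin p => ν) ≤
      Fintype.card (Fin p × Fin p) * max (mu4 ν) 1 * ∑ q, c q ^ 2 := by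
  have hint : ∀ q : Fin p × Fin p, Integrable
      (fun y => c q ^ 2 * (centeredProd q.1 q.2 y * centeredProd q.1 q.2 y))
      (Measure.pi fun _ : Fin p => ν) :=
    fun q => (integrable_centeredProd_mul hν_four _ _ _ _).const_mul _
  calc ∫ y, (∑ q, c q * centeredProd q.1 q.2 y) ^ 2 ∂(Measure.pi fun _ : Fin p => ν)
      ≤ ∫ y, Fintype.card (Fin p × Fin p) *
          ∑ q, c q ^ 2 * (centeredProd q.1 q.2 y * centeredProd q.1 q.2 y)
            ∂(Measure.pi fun _ : Fin p => ν) := by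
        refine integral_mono ?_ ((integrable_finsetSum _ fun q _ => hint q).const_mul _) fun y => ?_
        · exact (memLp_finsetSum _ fun q _ =>
            (memLp_centeredProd hν_four q.1 q.2).const_mul (c q)).integrable_sq
        -- Cauchy–Schwarz in place of orthogonality: the sum contains both `(k, l)` and `(l, k)`,
        -- whose centred products coincide.
        · have := sq_sum_le_card_mul_sum_sq (s := Finset.univ)
            (f := fun q : Fin p × Fin p => c q * centeredProd q.1 q.2 y)
          simp only [mul_pow, pow_two (centeredProd _ _ _)] at this
          exact this
    _ = Fintype.card (Fin p × Fin p) *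
          ∑ q : Fin p × Fin p, c q ^ 2 * (if q.1 = q.2 then mu4 ν else 1) := by
        rw [integral_const_mul, integral_finsetSum _ fun q _ => hint q]
        simp_rw [integral_const_mul, integral_centeredProd_sq hν_var]
    _ ≤ _ := by
        rw [mul_assoc, Finset.mul_sum _ _ (max _ _)]
        refine mul_le_mul_of_nonneg_left (Finset.sum_le_sum fun q _ => ?_) (Nat.cast_nonneg _)
        rw [mul_comm]
        refine mul_le_mul_of_nonneg_right ?_ (sq_nonneg _)
        split_ifs
        · exact le_max_left _ _
        · exact le_max_right _ _

/-- A weighted sum of centred products is negligible if the sum of the squares of the weights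
is. -/
theorem tendstoInMeasure_centeredSum [IsProbabilityMeasure P]
    (hν_four : MemLp (fun y : ℝ => y) 4 ν)
    (hν_mean : ∫ y, y ∂ν = 0) (hν_var : ∫ y, y ^ 2 ∂ν = 1)
    (hlaw : ∀ t, HasLaw (Y t) (Measure.pi fun _ => ν) P) (hindep : iIndepFun Y P)
    {c : ℕ → ℕ → Fin p × Fin p → ℝ} {s : ℕ → Finset ℕ}
    (hcq : ∀ q, Tendsto (fun T => ∑ t ∈ s T, c T t q ^ 2) atTop (𝓝 0)) :
    TendstoInMeasure P (fun T ω => ∑ t ∈ s T, ∑ q, c T t q * centeredProd q.1 q.2 (Y t ω))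
      atTop (fun _ => 0) := by
  have hc : Tendsto (fun T => ∑ t ∈ s T, ∑ q, c T t q ^ 2) atTop (𝓝 0) := by
    have := tendsto_finsetSum Finset.univ fun q _ => hcq q
    rw [Finset.sum_const_zero] at this
    exact this.congr fun T => Finset.sum_comm
  set g : ℕ → ℕ → (Fin p → ℝ) → ℝ := fun T t y => ∑ q, c T t q * centeredProd q.1 q.2 y with hg
  have hgm : ∀ T t, Measurable (g T t) := fun T t =>
    Finset.measurable_fun_sum _ fun q _ => (measurable_centeredProd q.1 q.2).const_mul _
  have hgL : ∀ T t, MemLp (g T t) 2 (Measure.pi fun _ : Fin p => ν) := fun T t =>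
    memLp_finsetSum _ fun q _ => (memLp_centeredProd hν_four q.1 q.2).const_mul _
  have hgY : ∀ T t, MemLp (fun ω => g T t (Y t ω)) 2 P := fun T t => by
    have := (hlaw t).map_eq ▸ hgL T t
    exact this.comp_of_map (hlaw t).aemeasurable
  have hg0 : ∀ T t, ∫ ω, g T t (Y t ω) ∂P = 0 := fun T t => by
    have := (hlaw t).integral_comp (f := g T t) (hgm T t).aestronglyMeasurable
    simp only [Function.comp_def] at this
    rw [this, hg, integral_finsetSum _ fun q _ =>
      ((memLp_centeredProd hν_four q.1 q.2).integrable (by norm_num)).const_mul _]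
    simp [integral_const_mul, integral_centeredProd hν_four hν_mean hν_var]
  set D : ℝ := Fintype.card (Fin p × Fin p) * max (mu4 ν) 1 with hD
  have hvar1 : ∀ T t, Var[fun ω => g T t (Y t ω); P] ≤ D * ∑ q, c T t q ^ 2 := fun T t => by
    rw [variance_of_integral_eq_zero (hgY T t).aemeasurable (hg0 T t)]
    have := (hlaw t).integral_comp (f := fun y => g T t y ^ 2)
      ((hgm T t).pow_const 2).aestronglyMeasurable
    simp only [Function.comp_def] at this
    rw [this]
    exact integral_sum_centeredProd_sq_le hν_four hν_var _
  have hvar : ∀ T, Var[fun ω => ∑ t ∈ s T, g T t (Y t ω); P] ≤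
      D * ∑ t ∈ s T, ∑ q, c T t q ^ 2 := fun T => by
    have := IndepFun.variance_sum (μ := P) (X := fun t ω => g T t (Y t ω)) (s := s T)
      (fun t _ => hgY T t) (fun i _ j _ hij =>
        (hindep.indepFun hij).comp (hgm T i) (hgm T j))
    rw [show (fun ω => ∑ t ∈ s T, g T t (Y t ω)) = ∑ t ∈ s T, fun ω => g T t (Y t ω) by
      ext ω; simp, this, Finset.mul_sum]
    exact Finset.sum_le_sum fun t _ => hvar1 T t
  have hL : ∀ T, MemLp (fun ω => ∑ t ∈ s T, g T t (Y t ω)) 2 P := fun T =>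
    memLp_finsetSum _ fun t _ => hgY T t
  have hmean : ∀ T, ∫ ω, ∑ t ∈ s T, g T t (Y t ω) ∂P = 0 := fun T => by
    rw [integral_finsetSum _ fun t _ => (hgY T t).integrable (by norm_num)]
    exact Finset.sum_eq_zero fun t _ => hg0 T t
  rw [tendstoInMeasure_iff_norm]
  intro ε hε
  have hup : Tendsto (fun T => ENNReal.ofReal (D * (∑ t ∈ s T, ∑ q, c T t q ^ 2) / ε ^ 2)) atTop
      (𝓝 0) := by
    have := (hc.const_mul D).div_const (ε ^ 2)
    simpa using ENNReal.tendsto_ofReal this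
  refine tendsto_of_tendsto_of_tendsto_of_le_of_le tendsto_const_nhds hup
    (fun _ => zero_le) fun T => ?_
  -- Chebyshev's inequality, with the variances of the independent summands added up.
  have := meas_ge_le_variance_div_sq (hL T) hε
  rw [hmean T] at this
  simp only [sub_zero] at this ⊢
  refine (this.trans (ENNReal.ofReal_le_ofReal ?_))
  gcongr
  exact hvar T

end Moments

/-! ### Characteristic functions and the one-dimensional limit theorem -/

section CharFun

/-- Telescoping: the factors are replaced one at a time, and those left untouched have modulus at
most `1`. -/
theorem norm_prod_sub_prod_le {ι : Type*} (s : Finset ι) (f g : ι → ℂ)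
    (hf : ∀ i ∈ s, ‖f i‖ ≤ 1) (hg : ∀ i ∈ s, ‖g i‖ ≤ 1) :
    ‖∏ i ∈ s, f i - ∏ i ∈ s, g i‖ ≤ ∑ i ∈ s, ‖f i - g i‖ := by
  classical
  induction s using Finset.induction with
  | empty => simp
  | insert a s ha ih =>
    rw [Finset.prod_insert ha, Finset.prod_insert ha, Finset.sum_insert ha]
    have h1 := ih (fun i hi => hf i (Finset.mem_insert_of_mem hi))
      fun i hi => hg i (Finset.mem_insert_of_mem hi)
    have h2 : ‖∏ i ∈ s, f i‖ ≤ 1 := by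
      rw [norm_prod]
      exact Finset.prod_le_one (fun _ _ => norm_nonneg _)
        fun i hi => hf i (Finset.mem_insert_of_mem hi)
    have h3 := hg a (Finset.mem_insert_self a s)
    calc ‖f a * ∏ i ∈ s, f i - g a * ∏ i ∈ s, g i‖
        = ‖(f a - g a) * ∏ i ∈ s, f i + g a * (∏ i ∈ s, f i - ∏ i ∈ s, g i)‖ := by
          congr 1; ring
      _ ≤ ‖f a - g a‖ * ‖∏ i ∈ s, f i‖ + ‖g a‖ * ‖∏ i ∈ s, f i - ∏ i ∈ s, g i‖ := by
          refine (norm_add_le _ _).trans ?_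
          rw [norm_mul, norm_mul]
      _ ≤ ‖f a - g a‖ * 1 + 1 * ∑ i ∈ s, ‖f i - g i‖ := by gcongr
      _ = _ := by ring

theorem charFun_sub_taylor_isLittleO {μ : Measure ℝ} [IsProbabilityMeasure μ] (hμ : MemLp id 2 μ)
    (h0 : ∫ x, x ∂μ = 0) :
    (fun t : ℝ => charFun μ t - (1 - (∫ x, x ^ 2 ∂μ : ℝ) * t ^ 2 / 2)) =o[𝓝 0]
      fun t => t ^ 2 := by
  have h := taylor_isLittleO_univ (x₀ := 0) (contDiff_charFun (n := 2) hμ)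
  have hT : ∀ t : ℝ, taylorWithinEval (charFun μ) 2 univ 0 t =
      1 - (∫ x, x ^ 2 ∂μ : ℝ) * t ^ 2 / 2 := fun t => by
    have := taylorWithinEval_charFun_two_zero (P := μ) (X := id) aemeasurable_id
      (by rwa [Measure.map_id]) t
    rw [Measure.map_id] at this
    rw [this]
    simp [h0]
  simpa only [hT, sub_zero] using h

/-- The characteristic function of a weighted sum of i.i.d. centred variables converges to that of
a Gaussian variable if the weights are uniformly negligible and the sum of their squares tends
to one. -/
theorem tendsto_prod_charFun {μ : Measure ℝ} [IsProbabilityMeasure μ] (hμ : MemLp id 2 μ)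
    (h0 : ∫ x, x ∂μ = 0) {v : NNReal} (hv : ∫ x, x ^ 2 ∂μ = v)
    {w : ℕ → ℕ → ℝ} {s : ℕ → Finset ℕ}
    (hmax : ∀ δ > 0, ∀ᶠ T in atTop, ∀ t ∈ s T, |w T t| ≤ δ)
    (hsum : Tendsto (fun T => ∑ t ∈ s T, w T t ^ 2) atTop (𝓝 1)) :
    Tendsto (fun T => ∏ t ∈ s T, charFun μ (w T t)) atTop (𝓝 (charFun (gaussianReal 0 v) 1)) := by
  have hg2 : ∫ x, x ^ 2 ∂(gaussianReal 0 v) = v := by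
    have := variance_of_integral_eq_zero (X := id) (μ := gaussianReal 0 v) aemeasurable_id
      (by simp)
    rw [variance_id_gaussianReal] at this
    exact this.symm
  -- Both laws have mean zero and variance `v`, so their second-order Taylor polynomials at `0`
  -- agree.
  have hdiff : (fun t : ℝ => charFun μ t - charFun (gaussianReal 0 v) t) =o[𝓝 0]
      fun t => t ^ 2 := by
    have h1 := charFun_sub_taylor_isLittleO hμ h0
    have h2 := charFun_sub_taylor_isLittleO (μ := gaussianReal 0 v)
      (memLp_id_gaussianReal 2) (by simp)
    rw [hv] at h1
    rw [hg2] at h2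
    simpa using h1.sub h2
  have hgauss : Tendsto (fun T => ∏ t ∈ s T, charFun (gaussianReal 0 v) (w T t)) atTop
      (𝓝 (charFun (gaussianReal 0 v) 1)) := by
    have heq : ∀ T, ∏ t ∈ s T, charFun (gaussianReal 0 v) (w T t) =
        Complex.exp (-(v * ((∑ t ∈ s T, w T t ^ 2 : ℝ) : ℂ) / 2)) := fun T => by
      simp_rw [charFun_gaussianReal]
      rw [← Complex.exp_sum]
      push_cast
      rw [Finset.mul_sum, Finset.sum_div, ← Finset.sum_neg_distrib]
      simp
    simp_rw [heq]
    rw [charFun_gaussianReal]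
    have hc : Continuous fun x : ℝ => Complex.exp (-(v * (x : ℂ) / 2)) := by fun_prop
    have := (hc.tendsto 1).comp hsum
    simpa [Function.comp_def] using this
  have hsub : Tendsto (fun T => ∏ t ∈ s T, charFun μ (w T t) -
      ∏ t ∈ s T, charFun (gaussianReal 0 v) (w T t)) atTop (𝓝 0) := by
    rw [NormedAddGroup.tendsto_nhds_zero]
    intro ε hε
    -- Since the squares of the weights eventually sum to less than `2`, the constant `ε / 2` gives
    -- a total error below `ε`.
    have hb := hdiff.bound (show 0 < ε / 2 by positivity)
    rw [Metric.eventually_nhds_iff] at hb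
    obtain ⟨δ, hδ, hb⟩ := hb
    filter_upwards [hmax (δ / 2) (by positivity), hsum.eventually_lt_const one_lt_two] with T h1 h2
    refine (norm_prod_sub_prod_le _ _ _ (fun _ _ => norm_charFun_le_one _)
      fun _ _ => norm_charFun_le_one _).trans_lt ?_
    calc ∑ t ∈ s T, ‖charFun μ (w T t) - charFun (gaussianReal 0 v) (w T t)‖
        ≤ ∑ t ∈ s T, ε / 2 * w T t ^ 2 := by
          refine Finset.sum_le_sum fun t ht => ?_
          have := hb (y := w T t) (by
            rw [Real.dist_eq, sub_zero]; linarith [h1 t ht])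
          simpa using this
      _ < ε := by
          rw [← Finset.mul_sum]
          nlinarith
  simpa using hsub.add hgauss

/-- The Cramér–Wold device: vector convergence is reduced to that of the scalar projections. -/
theorem charFun_map_eq_charFun_map_inner {Ω E : Type*} [MeasurableSpace Ω]
    [NormedAddCommGroup E] [InnerProductSpace ℝ E] [MeasurableSpace E] [BorelSpace E]
    [SecondCountableTopology E]
    {P : Measure Ω} {V : Ω → E} (hV : AEMeasurable V P) (θ : E) :
    charFun (P.map V) θ = charFun (P.map fun ω => inner ℝ (V ω) θ) 1 := by
  rw [charFun_apply, charFun_apply, integral_map hV (by fun_prop),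
    integral_map (by fun_prop) (by fun_prop)]
  simp

end CharFun

/-! ### Linear functionals of symmetric matrices -/

section Fold

variable {p : ℕ}

/-- Collects the coefficients of a symmetric matrix on and above its diagonal. -/
def foldUpper (θ : Fin p × Fin p → ℝ) (r : Fin p × Fin p) : ℝ :=
  ∑ q, if (min q.1 q.2, max q.1 q.2) = r then θ q else 0

/-- A functional of all `p²` entries sees only the upper triangle; after folding it is a combination
of orthogonal (or independent) terms. -/
theorem sum_mul_minMax (θ f : Fin p × Fin p → ℝ) :
    ∑ q, θ q * f (min q.1 q.2, max q.1 q.2) = ∑ r, foldUpper θ r * f r := by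
  simp_rw [foldUpper, Finset.sum_mul]
  rw [Finset.sum_comm]
  simp [ite_mul]

theorem foldUpper_eq_zero (θ : Fin p × Fin p → ℝ) {r : Fin p × Fin p} (hr : ¬ r.1 ≤ r.2) :
    foldUpper θ r = 0 := by
  refine Finset.sum_eq_zero fun q _ => if_neg fun h => hr ?_
  rw [← h]
  exact min_le_max

theorem centeredProd_minMax (k l : Fin p) :
    centeredProd (min k l) (max k l) = centeredProd k l := by
  rcases le_total k l with h | h
  · rw [min_eq_left h, max_eq_right h]
  · rw [min_eq_right h, max_eq_left h, centeredProd_comm]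

end Fold

/-! ### The Gaussian limit matrix -/

section Limit

variable {p : ℕ} {ν : Measure ℝ} [IsProbabilityMeasure ν]

/-- The variance of a linear functional of the limiting Gaussian matrix. -/
def limitVariance (m : ℝ) (θ : Fin p × Fin p → ℝ) : NNReal :=
  ∑ r, (foldUpper θ r ^ 2).toNNReal * if r.1 = r.2 then 1 else (1 / m).toNNReal

/-- Orthogonality kills the cross terms of the folded sum. Division by `μ₄` leaves `1` for diagonal
and `1/μ₄` for off-diagonal pairs. -/
theorem integral_sum_centeredProd_div_sq (hν_four : MemLp (fun y : ℝ => y) 4 ν)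
    (hν_mean : ∫ y, y ∂ν = 0) (hν_var : ∫ y, y ^ 2 ∂ν = 1) (hμ4 : 0 < mu4 ν)
    (θ : Fin p × Fin p → ℝ) :
    ∫ y, (∑ q, θ q * (centeredProd q.1 q.2 y / √(mu4 ν))) ^ 2 ∂(Measure.pi fun _ : Fin p => ν) =
      limitVariance (mu4 ν) θ := by
  have hfold : ∀ y : Fin p → ℝ, (∑ q, θ q * (centeredProd q.1 q.2 y / √(mu4 ν))) ^ 2 =
      (1 / mu4 ν) * ∑ r, ∑ r', foldUpper θ r * foldUpper θ r' *
        (centeredProd r.1 r.2 y * centeredProd r'.1 r'.2 y) := fun y => by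
    have h1 : ∑ q, θ q * (centeredProd q.1 q.2 y / √(mu4 ν)) =
        (∑ r, foldUpper θ r * centeredProd r.1 r.2 y) / √(mu4 ν) := by
      rw [← sum_mul_minMax θ fun r => centeredProd r.1 r.2 y]
      simp only [centeredProd_minMax, mul_div_assoc, Finset.sum_div]
    rw [h1, div_pow, Real.sq_sqrt hμ4.le, pow_two, Finset.sum_mul_sum, div_eq_inv_mul, one_div]
    congr 1
    refine Finset.sum_congr rfl fun r _ => Finset.sum_congr rfl fun r' _ => ?_
    ring
  simp_rw [hfold]
  rw [integral_const_mul, integral_finsetSum _ fun r _ => integrable_finsetSum _ fun r' _ =>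
    (integrable_centeredProd_mul hν_four _ _ _ _).const_mul _]
  have hin : ∀ r : Fin p × Fin p, ∫ y, ∑ r', foldUpper θ r * foldUpper θ r' *
        (centeredProd r.1 r.2 y * centeredProd r'.1 r'.2 y) ∂(Measure.pi fun _ : Fin p => ν) =
      foldUpper θ r ^ 2 * if r.1 = r.2 then mu4 ν else 1 := fun r => by
    rw [integral_finsetSum _ fun r' _ =>
      (integrable_centeredProd_mul hν_four _ _ _ _).const_mul _]
    simp_rw [integral_const_mul]
    rw [Finset.sum_eq_single r, integral_centeredProd_sq hν_var, pow_two]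
    · intro r' _ hne
      by_cases hr : r.1 ≤ r.2
      · by_cases hr' : r'.1 ≤ r'.2
        · rw [integral_centeredProd_mul_of_ne hν_four hν_mean hν_var hr hr'
            (fun h => hne h.symm), mul_zero]
        · rw [foldUpper_eq_zero θ hr']; simp
      · rw [foldUpper_eq_zero θ hr]; simp
    · simp
  simp_rw [hin]
  rw [limitVariance, Finset.mul_sum]
  push_cast
  refine Finset.sum_congr rfl fun r _ => ?_
  rw [Real.coe_toNNReal _ (sq_nonneg _)]
  split_ifs
  · field_simp
    simp
  · rw [Real.coe_toNNReal _ (one_div_pos.2 hμ4).le]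
    ring

theorem measurable_toLp_symmOf : Measurable fun z : Fin p × Fin p → ℝ =>
    (WithLp.toLp 2 fun q : Fin p × Fin p => symmOf z q.1 q.2 :
      EuclideanSpace ℝ (Fin p × Fin p)) := by
  refine (WithLp.measurable_toLp 2 _).comp (measurable_pi_iff.2 fun q => ?_)
  unfold symmOf
  fun_prop

theorem charFun_symmOf (m : ℝ) (θ : EuclideanSpace ℝ (Fin p × Fin p)) :
    charFun ((gaussianEntries p m).map fun z =>
      WithLp.toLp 2 fun q : Fin p × Fin p => symmOf z q.1 q.2) θ =
      charFun (gaussianReal 0 (limitVariance m θ.ofLp)) 1 := by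
  have hpi := charFun_pi (μ := fun ij : Fin p × Fin p =>
    gaussianReal 0 (if ij.1 = ij.2 then 1 else (1 / m).toNNReal))
    (WithLp.toLp 2 (foldUpper θ.ofLp))
  have heq : charFun ((gaussianEntries p m).map fun z =>
      WithLp.toLp 2 fun q : Fin p × Fin p => symmOf z q.1 q.2) θ =
      charFun ((gaussianEntries p m).map (WithLp.toLp 2)) (WithLp.toLp 2 (foldUpper θ.ofLp)) := by
    rw [charFun_map_eq_charFun_map_inner measurable_toLp_symmOf.aemeasurable,
      charFun_map_eq_charFun_map_inner (WithLp.measurable_toLp 2 _).aemeasurable]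
    congr 1
    refine congrArg (Measure.map · (gaussianEntries p m)) (funext fun z => ?_)
    simp only [PiLp.inner_apply, RCLike.inner_apply, conj_trivial, symmOf]
    exact sum_mul_minMax θ.ofLp z
  rw [heq, hpi]
  simp_rw [charFun_gaussianReal]
  rw [← Complex.exp_sum, limitVariance]
  congr 1
  push_cast
  simp only [mul_zero, zero_mul, zero_sub, one_pow, mul_one]
  rw [Finset.sum_div, ← Finset.sum_neg_distrib]
  refine Finset.sum_congr rfl fun r _ => ?_
  have : (foldUpper θ.ofLp r : ℂ) ^ 2 = (((foldUpper θ.ofLp r ^ 2).toNNReal : ℝ) : ℂ) := by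
    rw [← Complex.ofReal_pow, Real.coe_toNNReal _ (sq_nonneg _)]
  rw [mul_comm, this]

variable {Ω : Type*} [MeasurableSpace Ω] {P : Measure Ω} [IsProbabilityMeasure P]
  {Y : ℕ → Ω → Fin p → ℝ}

/-- The central limit theorem for weighted sums of the centred outer products `Y_t Y_t' - I`. -/
theorem tendstoInDistribution_centeredSum (hν_four : MemLp (fun y : ℝ => y) 4 ν)
    (hν_mean : ∫ y, y ∂ν = 0) (hν_var : ∫ y, y ^ 2 ∂ν = 1) (hμ4 : 0 < mu4 ν)
    (hlaw : ∀ t, HasLaw (Y t) (Measure.pi fun _ => ν) P) (hindep : iIndepFun Y P)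
    {w : ℕ → ℕ → ℝ} {s : ℕ → Finset ℕ}
    (hmax : ∀ δ > 0, ∀ᶠ T in atTop, ∀ t ∈ s T, |w T t| ≤ δ)
    (hsum : Tendsto (fun T => ∑ t ∈ s T, w T t ^ 2) atTop (𝓝 1)) :
    TendstoInDistribution
      (fun T ω i j => ∑ t ∈ s T, w T t * (centeredProd i j (Y t ω) / √(mu4 ν)))
      atTop symmOf (fun _ => P) (gaussianEntries p (mu4 ν)) := by
  have hmeas : ∀ t, ∀ q : Fin p × Fin p,
      AEMeasurable (fun ω => centeredProd q.1 q.2 (Y t ω) / √(mu4 ν)) P := fun t q =>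
    ((measurable_centeredProd q.1 q.2).comp_aemeasurable (hlaw t).aemeasurable).div_const _
  -- The convergence criterion by characteristic functions is applied in a Euclidean space; a
  -- continuous map then returns to arrays.
  have key : TendstoInDistribution
      (fun T ω => (WithLp.toLp 2 fun q : Fin p × Fin p =>
        ∑ t ∈ s T, w T t * (centeredProd q.1 q.2 (Y t ω) / √(mu4 ν)) :
          EuclideanSpace ℝ (Fin p × Fin p)))
      atTop (fun z => WithLp.toLp 2 fun q : Fin p × Fin p => symmOf z q.1 q.2)
      (fun _ => P) (gaussianEntries p (mu4 ν)) := by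
    have hV : ∀ T, AEMeasurable (fun ω => (WithLp.toLp 2 fun q : Fin p × Fin p =>
        ∑ t ∈ s T, w T t * (centeredProd q.1 q.2 (Y t ω) / √(mu4 ν)) :
          EuclideanSpace ℝ (Fin p × Fin p))) P := fun T => by
      refine (WithLp.measurable_toLp 2 _).comp_aemeasurable (aemeasurable_pi_iff.2 fun q => ?_)
      exact Finset.aemeasurable_fun_sum _ fun t _ => (hmeas t q).const_mul _
    refine ⟨hV, ?_, ProbabilityMeasure.tendsto_iff_tendsto_charFun.2 fun θ => ?_⟩
    · exact measurable_toLp_symmOf.aemeasurable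
    simp only [ProbabilityMeasure.coe_mk]
    rw [charFun_symmOf]
    set g : (Fin p → ℝ) → ℝ := fun y =>
      ∑ q, θ.ofLp q * (centeredProd q.1 q.2 y / √(mu4 ν)) with hg
    have hgm : Measurable g := Finset.measurable_fun_sum _ fun q _ =>
      ((measurable_centeredProd q.1 q.2).div_const _).const_mul _
    set μ := (Measure.pi fun _ : Fin p => ν).map g with hμ
    have : IsProbabilityMeasure μ := Measure.isProbabilityMeasure_map hgm.aemeasurable
    have hgL : MemLp g 2 (Measure.pi fun _ : Fin p => ν) := by
      refine memLp_finsetSum _ fun q _ => MemLp.const_mul ?_ _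
      simp_rw [div_eq_inv_mul]
      exact (memLp_centeredProd hν_four q.1 q.2).const_mul _
    have hμL : MemLp id 2 μ := (memLp_map_measure_iff aestronglyMeasurable_id
      hgm.aemeasurable).2 hgL
    have hμ0 : ∫ x, x ∂μ = 0 := by
      rw [hμ, integral_map hgm.aemeasurable (by fun_prop), hg, integral_finsetSum]
      · simp [integral_const_mul, integral_div, integral_centeredProd hν_four hν_mean hν_var]
      · exact fun q _ =>
          (((memLp_centeredProd hν_four q.1 q.2).integrable (by norm_num)).div_const _).const_mul _
    have hμ2 : ∫ x, x ^ 2 ∂μ = limitVariance (mu4 ν) θ.ofLp := by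
      rw [hμ, integral_map hgm.aemeasurable (by fun_prop), hg]
      exact integral_sum_centeredProd_div_sq hν_four hν_mean hν_var hμ4 _
    have hgμ : HasLaw g μ (Measure.pi fun _ : Fin p => ν) :=
      { aemeasurable := hgm.aemeasurable, map_eq := rfl }
    have hgY : ∀ t, HasLaw (fun ω => g (Y t ω)) μ P := fun t => hgμ.comp (hlaw t)
    refine (tendsto_prod_charFun hμL hμ0 hμ2 hmax hsum).congr fun T => ?_
    rw [charFun_map_eq_charFun_map_inner (hV T)]
    have hinner : (fun ω => inner ℝ ((WithLp.toLp 2 fun q : Fin p × Fin p =>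
        ∑ t ∈ s T, w T t * (centeredProd q.1 q.2 (Y t ω) / √(mu4 ν)) :
          EuclideanSpace ℝ (Fin p × Fin p))) θ) = fun ω => ∑ t ∈ s T, w T t * g (Y t ω) := by
      ext ω
      simp only [PiLp.inner_apply, RCLike.inner_apply, conj_trivial, hg, Finset.mul_sum]
      rw [Finset.sum_comm]
      refine Finset.sum_congr rfl fun t _ => Finset.sum_congr rfl fun q _ => ?_
      ring
    rw [hinner, iIndepFun.charFun_map_fun_finsetSum_eq_prod
      (fun t _ => (hgY t).aemeasurable.const_mul _)]
    · rw [Finset.prod_apply]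
      refine Finset.prod_congr rfl fun t _ => ?_
      rw [charFun_map_mul_comp (hgY t).aemeasurable, mul_one, (hgY t).map_eq]
    · exact (hindep.comp (fun t y => w T t * g y) fun t => hgm.const_mul _).restrict _
  have hcont : Continuous fun (x : EuclideanSpace ℝ (Fin p × Fin p)) (i j : Fin p) =>
      x.ofLp (i, j) := by fun_prop
  exact key.continuous_comp hcont

end Limit

/-! ### Continuous mapping -/

section ContinuousMapping

variable {p : ℕ} {Ω : Type*} [MeasurableSpace Ω] {P : Measure Ω}

/-- The continuous mapping theorem for convergence in probability to a constant. -/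
theorem TendstoInProb.comp {B : ℕ → Ω → Matrix (Fin p) (Fin p) ℝ} {C : Matrix (Fin p) (Fin p) ℝ}
    (hB : TendstoInProb P B C) {s : Set (Matrix (Fin p) (Fin p) ℝ)} (hs : ∀ T ω, B T ω ∈ s)
    {f : Matrix (Fin p) (Fin p) ℝ → Matrix (Fin p) (Fin p) ℝ} (hf : ContinuousWithinAt f s C) :
    TendstoInProb P (fun T ω => f (B T ω)) (f C) := by
  intro i j
  rw [tendstoInMeasure_iff_dist]
  intro ε hε
  have hfij : Tendsto (fun M => f M i j) (𝓝[s] C) (𝓝 (f C i j)) :=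
    ((continuous_apply_apply i j).tendsto (f C)).comp hf
  have hev : ∀ᶠ M in 𝓝[s] C, dist (f M i j) (f C i j) < ε :=
    hfij.eventually (Metric.ball_mem_nhds _ hε)
  rw [eventually_nhdsWithin_iff] at hev
  obtain ⟨δ, hδ, hδs⟩ := Metric.mem_nhds_iff (α := Fin p → Fin p → ℝ).1 hev
  -- Union bound over the entries; monotonicity of the measure suffices, so `f` need not be
  -- measurable.
  have hsum : Tendsto (fun T => ∑ q : Fin p × Fin p,
      P {ω | δ ≤ dist (B T ω q.1 q.2) (C q.1 q.2)}) atTop (𝓝 0) := by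
    rw [← Finset.sum_const_zero (s := (Finset.univ : Finset (Fin p × Fin p)))]
    exact tendsto_finsetSum _ fun q _ => tendstoInMeasure_iff_dist.1 (hB q.1 q.2) δ hδ
  refine tendsto_of_tendsto_of_tendsto_of_le_of_le tendsto_const_nhds hsum
    (fun _ => zero_le) fun T => ?_
  refine (measure_mono fun ω hω => ?_).trans (measure_biUnion_finset_le Finset.univ _)
  simp only [Finset.mem_univ, iUnion_true, mem_iUnion, mem_ofPred_eq] at hω ⊢
  by_contra! hcon
  have hmem : dist (α := Fin p → Fin p → ℝ) (B T ω) C < δ :=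
    (dist_pi_lt_iff hδ).2 fun k => (dist_pi_lt_iff hδ).2 fun l => hcon (k, l)
  exact hω.not_gt (hδs (Metric.mem_ball.2 hmem) (hs T ω))

end ContinuousMapping

/-! ### Square roots, inverses and polar decomposition -/

section Root

variable {p : ℕ}

-- `Real.sqrt` is continuous on the whole line, being `0` on negatives, so no positivity is needed.
-- This matters because a kernel with negative values can make `Â²(u)` indefinite.
open scoped Matrix.Norms.L2Operator in
theorem continuousOn_root :
    ContinuousOn (root : Matrix (Fin p) (Fin p) ℝ → _) {S | IsSelfAdjoint S} :=
  ContinuousOn.cfc_of_mem_nhdsSet (s := univ) Real.sqrt univ_mem continuousOn_id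
    (fun _ h => h) Real.continuous_sqrt.continuousOn

theorem isSelfAdjoint_root (S : Matrix (Fin p) (Fin p) ℝ) : IsSelfAdjoint (root S) :=
  cfc_predicate _ _

theorem transpose_root (S : Matrix (Fin p) (Fin p) ℝ) : (root S)ᵀ = root S := by
  have := isSelfAdjoint_root S
  rwa [isSelfAdjoint_iff, Matrix.star_eq_conjTranspose, Matrix.conjTranspose_eq_transpose_of_trivial]
    at this

theorem spectrum_nonneg_of_posSemidef {S : Matrix (Fin p) (Fin p) ℝ} (hS : S.PosSemidef) :
    ∀ x ∈ spectrum ℝ S, 0 ≤ x := by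
  intro x hx
  rw [hS.isHermitian.spectrum_real_eq_range_eigenvalues] at hx
  obtain ⟨i, rfl⟩ := hx
  exact hS.eigenvalues_nonneg i

theorem root_mul_root {S : Matrix (Fin p) (Fin p) ℝ} (hS : S.PosSemidef) :
    root S * root S = S := by
  have hsa : IsSelfAdjoint S := hS.isHermitian
  rw [root, ← cfc_mul Real.sqrt Real.sqrt S Real.continuous_sqrt.continuousOn
    Real.continuous_sqrt.continuousOn]
  conv_rhs => rw [← cfc_id ℝ S hsa]
  exact cfc_congr fun x hx => Real.mul_self_sqrt (spectrum_nonneg_of_posSemidef hS x hx)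

theorem root_mul_self {S : Matrix (Fin p) (Fin p) ℝ} (hS : S.PosSemidef) :
    root (S * S) = S := by
  have hsa : IsSelfAdjoint S := hS.isHermitian
  have h2 : S * S = cfc (fun x : ℝ => x * x) S := by
    rw [cfc_mul (fun x : ℝ => x) (fun x : ℝ => x) S continuousOn_id continuousOn_id,
      cfc_id' ℝ S hsa]
  rw [root, h2, ← cfc_comp Real.sqrt (fun x : ℝ => x * x) S hsa
    Real.continuous_sqrt.continuousOn (by fun_prop)]
  conv_rhs => rw [← cfc_id ℝ S hsa]
  exact cfc_congr fun x hx => Real.sqrt_mul_self (spectrum_nonneg_of_posSemidef hS x hx)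

theorem continuousAt_inv {S : Matrix (Fin p) (Fin p) ℝ} (hS : IsUnit S.det) :
    ContinuousAt (fun M : Matrix (Fin p) (Fin p) ℝ => M⁻¹) S := by
  have : (fun M : Matrix (Fin p) (Fin p) ℝ => M⁻¹) = fun M => (M.det)⁻¹ • M.adjugate := by
    ext1 M
    rw [Matrix.inv_def, Ring.inverse_eq_inv']
  rw [this]
  have hdet : Continuous fun M : Matrix (Fin p) (Fin p) ℝ => M.det :=
    continuous_id.matrix_det
  exact (hdet.continuousAt.inv₀ hS.ne_zero).smul continuous_id.matrix_adjugate.continuousAt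

/-- The polar decomposition of an invertible matrix. -/
theorem exists_root_mul_orthogonal {S : Matrix (Fin p) (Fin p) ℝ} (hS : IsUnit S.det) :
    IsUnit (root (S * Sᵀ)).det ∧ ∃ Q ∈ Matrix.orthogonalGroup (Fin p) ℝ,
      root (S * Sᵀ) * Q = S ∧ (S.PosDef → Q = 1) := by
  have hpsd : (S * Sᵀ).PosSemidef := by
    simpa using Matrix.posSemidef_self_mul_conjTranspose S
  have hR := root_mul_root hpsd
  have hRdet : IsUnit (root (S * Sᵀ)).det := by
    have := congrArg Matrix.det hR
    rw [Matrix.det_mul, Matrix.det_mul, Matrix.det_transpose] at this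
    exact isUnit_of_mul_isUnit_left (this ▸ hS.mul hS)
  -- With `R = root (S * Sᵀ)` the factor must be `R⁻¹ S`; it is orthogonal because `R⁻¹ S Sᵀ R⁻¹ =
  -- R⁻¹ R R R⁻¹ = 1`.
  refine ⟨hRdet, (root (S * Sᵀ))⁻¹ * S, ?_, Matrix.mul_nonsing_inv_cancel_left _ _ hRdet, ?_⟩
  · rw [Matrix.mem_orthogonalGroup_iff, Matrix.transpose_mul,
      Matrix.transpose_nonsing_inv, transpose_root]
    calc (root (S * Sᵀ))⁻¹ * S * (Sᵀ * (root (S * Sᵀ))⁻¹)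
        = (root (S * Sᵀ))⁻¹ * (S * Sᵀ) * (root (S * Sᵀ))⁻¹ := by simp only [Matrix.mul_assoc]
      _ = (root (S * Sᵀ))⁻¹ * (root (S * Sᵀ) * root (S * Sᵀ)) * (root (S * Sᵀ))⁻¹ := by rw [hR]
      _ = 1 := by
        rw [Matrix.nonsing_inv_mul_cancel_left _ _ hRdet, Matrix.mul_nonsing_inv _ hRdet]
  · intro hpd
    have hsymm : Sᵀ = S := by
      rw [← Matrix.conjTranspose_eq_transpose_of_trivial]
      exact hpd.isHermitian
    rw [hsymm, root_mul_self hpd.posSemidef, Matrix.nonsing_inv_mul _ hS]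

end Root

/-! ### Smoothing bias for Lipschitz functions -/

section Smoothing

/-- A function on `(0, 1]` which is Lipschitz at the point `u`. -/
def LipAt (u : ℝ) (f : ℝ → ℝ) : Prop :=
  ∃ C, 0 ≤ C ∧ ∀ v ∈ Ioc (0 : ℝ) 1, |f v - f u| ≤ C * |v - u|

theorem abs_sub_le_one {u v : ℝ} (hu : u ∈ Ioo (0 : ℝ) 1) (hv : v ∈ Ioc (0 : ℝ) 1) :
    |v - u| ≤ 1 := by
  rw [abs_le]
  constructor <;> linarith [hu.1, hu.2, hv.1, hv.2]

/-- The grid contains the point `1`, where the value is arbitrary. As `1` stays away from `u`,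
enlarging the constant absorbs it. -/
theorem LipAt.of_lipschitzOnWith {u : ℝ} (hu : u ∈ Ioo (0 : ℝ) 1) {f : ℝ → ℝ}
    (hf : ∃ L, LipschitzOnWith L f (Ioo 0 1)) : LipAt u f := by
  obtain ⟨L, hL⟩ := hf
  have h1u : 0 < |1 - u| := abs_pos.2 (by linarith [hu.2])
  refine ⟨max L (|f 1 - f u| / |1 - u|), by positivity, fun v hv => ?_⟩
  rcases hv.2.lt_or_eq with hv1 | rfl
  · have := hL.dist_le_mul v ⟨hv.1, hv1⟩ u hu
    rw [Real.dist_eq, Real.dist_eq] at this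
    exact this.trans (mul_le_mul_of_nonneg_right (le_max_left _ _) (abs_nonneg _))
  · rw [← div_le_iff₀ h1u]
    exact le_max_right _ _

theorem LipAt.exists_bound {u : ℝ} (hu : u ∈ Ioo (0 : ℝ) 1) {f : ℝ → ℝ} (hf : LipAt u f) :
    ∃ D, 0 ≤ D ∧ ∀ v ∈ Ioc (0 : ℝ) 1, |f v| ≤ D := by
  obtain ⟨C, hC0, hC⟩ := hf
  refine ⟨|f u| + C, by positivity, fun v hv => ?_⟩
  have h1 := hC v hv
  have h2 : C * |v - u| ≤ C * 1 := mul_le_mul_of_nonneg_left (abs_sub_le_one hu hv) hC0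
  have h3 := abs_sub_abs_le_abs_sub (f v) (f u)
  linarith

theorem LipAt.mul {u : ℝ} (hu : u ∈ Ioo (0 : ℝ) 1) {f g : ℝ → ℝ} (hf : LipAt u f)
    (hg : LipAt u g) : LipAt u fun v => f v * g v := by
  obtain ⟨D, hD0, hD⟩ := hg.exists_bound hu
  obtain ⟨C, hC0, hC⟩ := hf
  obtain ⟨C', hC0', hC'⟩ := hg
  refine ⟨C * D + |f u| * C', by positivity, fun v hv => ?_⟩
  calc |f v * g v - f u * g u| = |(f v - f u) * g v + f u * (g v - g u)| := by ring_nf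
    _ ≤ |f v - f u| * |g v| + |f u| * |g v - g u| := by
      rw [← abs_mul, ← abs_mul]; exact abs_add_le _ _
    _ ≤ C * |v - u| * D + |f u| * (C' * |v - u|) := by
      gcongr
      · exact hC v hv
      · exact hD v hv
      · exact hC' v hv
    _ = _ := by ring

theorem LipAt.sum {ι : Type*} {u : ℝ} {f : ι → ℝ → ℝ} (s : Finset ι)
    (hf : ∀ i ∈ s, LipAt u (f i)) : LipAt u fun v => ∑ i ∈ s, f i v := by
  choose! C hC0 hC using hf
  refine ⟨∑ i ∈ s, C i, Finset.sum_nonneg fun i hi => hC0 i hi, fun v hv => ?_⟩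
  rw [← Finset.sum_sub_distrib, Finset.sum_mul]
  exact (Finset.abs_sum_le_sum_abs _ _).trans (Finset.sum_le_sum fun i hi => hC i hi v hv)

theorem natCast_div_mem_Ioc {T t : ℕ} (ht : t ∈ Finset.Icc 1 T) :
    (t : ℝ) / T ∈ Ioc (0 : ℝ) 1 := by
  rw [Finset.mem_Icc] at ht
  have h1 : (0 : ℝ) < t := by exact_mod_cast ht.1
  have h2 : (t : ℝ) ≤ T := by exact_mod_cast ht.2
  have h3 : (0 : ℝ) < T := h1.trans_le h2
  exact ⟨by positivity, (div_le_one h3).2 h2⟩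

variable {K : ℝ → ℝ}

/-- The bias of a kernel smoother on the uniform grid. -/
theorem IsKernel.exists_abs_smooth_sub_le (hK : IsKernel K) {u : ℝ} (hu : u ∈ Ioo (0 : ℝ) 1)
    {f : ℝ → ℝ} (hf : LipAt u f) :
    ∃ C, 0 ≤ C ∧ ∀ T : ℕ, 0 < T → ∀ h : ℝ, 0 < h →
      |(1 / (T : ℝ)) * ∑ t ∈ Finset.Icc 1 T, scaledKernel K h (u - t / T) * f (t / T) - f u| ≤
        C * (h + 1 / (T * h)) := by
  obtain ⟨C₁, hC₁, h₁⟩ := hK.exists_abs_kernelSum_sub_one_le hu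
  obtain ⟨C₂, hC₂, h₂⟩ := hK.exists_kernelSum_abs_mul_le hu
  obtain ⟨L, hL, hfL⟩ := hf
  refine ⟨L * C₂ + |f u| * C₁, by positivity, fun T hT h hh => ?_⟩
  have hT' : (0 : ℝ) < T := by exact_mod_cast hT
  -- The variation of `f` around `u` is separated from the failure of the kernel weights to sum to
  -- one.
  have hsplit : (1 / (T : ℝ)) * ∑ t ∈ Finset.Icc 1 T, scaledKernel K h (u - t / T) * f (t / T) -
      f u = (1 / (T * h)) * ∑ t ∈ Finset.Icc 1 T,
        K (h⁻¹ * (u - t / T)) * (f (t / T) - f u) +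
      f u * ((1 / (T * h)) * ∑ t ∈ Finset.Icc 1 T, K (h⁻¹ * (u - t / T)) - 1) := by
    simp only [scaledKernel, mul_sub, Finset.sum_sub_distrib, ← Finset.sum_mul, mul_assoc,
      ← Finset.mul_sum]
    field_simp
    ring
  rw [hsplit]
  refine (abs_add_le _ _).trans ?_
  rw [add_mul, abs_mul (f u), mul_assoc |f u|]
  refine add_le_add ?_ (mul_le_mul_of_nonneg_left (h₁ T hT h hh) (abs_nonneg _))
  rw [abs_mul, abs_of_pos (show 0 < 1 / (T * h) by positivity), mul_assoc L]
  refine le_trans ?_ (mul_le_mul_of_nonneg_left (h₂ T hT h hh) hL)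
  rw [mul_left_comm, Finset.mul_sum _ _ L]
  refine mul_le_mul_of_nonneg_left ?_ (by positivity)
  refine (Finset.abs_sum_le_sum_abs _ _).trans (Finset.sum_le_sum fun t ht => ?_)
  rw [abs_mul, mul_left_comm]
  exact mul_le_mul_of_nonneg_left (hfL _ (natCast_div_mem_Ioc ht)) (abs_nonneg _)

/-- A function on `(0, 1)` which extends to a continuous function of bounded variation. -/
def ExtendsBV (f : ℝ → ℝ) : Prop :=
  ∃ g, Continuous g ∧ BoundedVariationOn g (Icc 0 1) ∧ EqOn f g (Ioo 0 1)

theorem ExtendsBV.of_lipschitzOnWith {f : ℝ → ℝ} (hf : ∃ L, LipschitzOnWith L f (Ioo 0 1)) :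
    ExtendsBV f := by
  obtain ⟨L, hL⟩ := hf
  obtain ⟨g, hg, hfg⟩ := hL.extend_real
  refine ⟨g, hg.continuous, ?_, hfg⟩
  have := hg.locallyBoundedVariationOn (Icc (0 : ℝ) 1) 0 1 (by simp) (by simp)
  simpa using this

theorem ExtendsBV.mul {f g : ℝ → ℝ} (hf : ExtendsBV f) (hg : ExtendsBV g) :
    ExtendsBV fun v => f v * g v := by
  obtain ⟨f', h1, h2, h3⟩ := hf
  obtain ⟨g', h1', h2', h3'⟩ := hg
  exact ⟨fun v => f' v * g' v, h1.mul h1', h2.fun_mul h2',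
    fun v hv => by simp only [h3 hv, h3' hv]⟩

theorem boundedVariationOn_add {f g : ℝ → ℝ} {s : Set ℝ} (hf : BoundedVariationOn f s)
    (hg : BoundedVariationOn g s) : BoundedVariationOn (fun v => f v + g v) s := by
  refine ne_top_of_le_ne_top (ENNReal.add_ne_top.2 ⟨hf, hg⟩) (iSup_le fun q => ?_)
  refine (Finset.sum_le_sum fun i _ => edist_add_add_le _ _ _ _).trans ?_
  rw [Finset.sum_add_distrib]
  exact add_le_add (eVariationOn.sum_le q.2.2.1 q.2.2.2) (eVariationOn.sum_le q.2.2.1 q.2.2.2)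

theorem ExtendsBV.sum {ι : Type*} {f : ι → ℝ → ℝ} (s : Finset ι)
    (hf : ∀ i ∈ s, ExtendsBV (f i)) : ExtendsBV fun v => ∑ i ∈ s, f i v := by
  choose! g h1 h2 h3 using hf
  refine ⟨fun v => ∑ i ∈ s, g i v, continuous_finsetSum s h1, ?_,
    fun v hv => Finset.sum_congr rfl fun i hi => h3 i hi hv⟩
  clear h1 h3
  classical
  induction s using Finset.induction with
  | empty =>
    simp only [Finset.sum_empty, BoundedVariationOn]
    rw [eVariationOn.constant_on (by simp)]
    simp
  | insert a s ha ih =>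
    simp_rw [Finset.sum_insert ha]
    exact boundedVariationOn_add (h2 a (Finset.mem_insert_self a s))
      (ih fun i hi => h2 i (Finset.mem_insert_of_mem hi))

theorem ExtendsBV.intervalIntegrable {f : ℝ → ℝ} (hf : ExtendsBV f) :
    IntervalIntegrable f volume 0 1 := by
  obtain ⟨g, hg, -, hfg⟩ := hf
  refine (hg.intervalIntegrable 0 1).congr_uIoo ?_
  rw [uIoo_of_le zero_le_one]
  exact hfg.symm

/-- On the grid `f` and its extension can differ only at `t = T`, which costs `|f 1 - g 1| / T`; the
integral does not see the endpoint. -/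
theorem ExtendsBV.exists_abs_riemannSum_sub_le {f : ℝ → ℝ} (hf : ExtendsBV f) :
    ∃ C, 0 ≤ C ∧ ∀ T : ℕ, 0 < T →
      |(1 / (T : ℝ)) * ∑ t ∈ Finset.Icc 1 T, f (t / T) - ∫ v in (0 : ℝ)..1, f v| ≤ C / T := by
  obtain ⟨g, hg, hbv, hfg⟩ := hf
  refine ⟨|f 1 - g 1| + (eVariationOn g (Icc 0 1)).toReal, by positivity, fun T hT => ?_⟩
  have hT' : (0 : ℝ) < T := by exact_mod_cast hT
  have hint : ∫ v in (0 : ℝ)..1, f v = ∫ v in (0 : ℝ)..1, g v :=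
    intervalIntegral.integral_congr_uIoo (by rwa [uIoo_of_le zero_le_one])
  have hsum : ∑ t ∈ Finset.Icc 1 T, f (t / T) =
      (f 1 - g 1) + ∑ t ∈ Finset.Icc 1 T, g (t / T) := by
    rw [← sub_eq_iff_eq_add, ← Finset.sum_sub_distrib, Finset.sum_eq_single T]
    · rw [div_self hT'.ne']
    · intro t ht hne
      have h1 := natCast_div_mem_Ioc ht
      rw [sub_eq_zero]
      refine hfg ⟨h1.1, lt_of_le_of_ne h1.2 fun h => hne ?_⟩
      rw [div_eq_one_iff_eq hT'.ne'] at h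
      exact_mod_cast h
    · intro h
      exact absurd (Finset.mem_Icc.2 ⟨hT, le_rfl⟩) h
  have key := abs_riemannSum_sub_integral_le hbv (hg.intervalIntegrable 0 1) hT
  rw [hint, hsum, mul_add, add_sub_assoc, add_div]
  refine (abs_add_le _ _).trans (add_le_add ?_ key)
  rw [abs_mul, abs_of_pos (by positivity), one_div, inv_mul_eq_div]

end Smoothing

/-! ### Rates in the bandwidth and sizes of the weights -/

section Bandwidth

variable {h : ℕ → ℝ}

theorem eventually_bandwidth_pos
    (h_lower : Tendsto (fun T : ℕ => (T : ℝ) * h T) atTop atTop) : ∀ᶠ T in atTop, 0 < h T := by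
  filter_upwards [h_lower.eventually_gt_atTop 0] with T hT
  exact pos_of_mul_pos_right hT (Nat.cast_nonneg T)

theorem tendsto_rate (h_zero : Tendsto h atTop (𝓝 0))
    (h_lower : Tendsto (fun T : ℕ => (T : ℝ) * h T) atTop atTop) :
    Tendsto (fun T : ℕ => h T + 1 / (T * h T)) atTop (𝓝 0) := by
  simpa using h_zero.add (h_lower.const_div_atTop 1)

/-- The two terms are `√(Th³)` and `1/√(Th)`; this is where undersmoothing, `Th³ → 0`, enters. -/
theorem tendsto_sqrt_mul_rate
    (h_lower : Tendsto (fun T : ℕ => (T : ℝ) * h T) atTop atTop)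
    (h_upper : Tendsto (fun T : ℕ => (T : ℝ) * h T ^ 3) atTop (𝓝 0)) :
    Tendsto (fun T : ℕ => √(T * h T) * (h T + 1 / (T * h T))) atTop (𝓝 0) := by
  have h1 : Tendsto (fun T : ℕ => √(T * h T ^ 3)) atTop (𝓝 0) := by
    have := (Real.continuous_sqrt.tendsto 0).comp h_upper
    rwa [Real.sqrt_zero] at this
  have h2 : Tendsto (fun T : ℕ => 1 / √(T * h T)) atTop (𝓝 0) :=
    (Real.tendsto_sqrt_atTop.comp h_lower).const_div_atTop 1
  have := h1.add h2
  rw [add_zero] at this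
  refine this.congr' ?_
  filter_upwards [h_lower.eventually_gt_atTop 0, eventually_bandwidth_pos h_lower] with T hT hh
  have h3 : √(T * h T ^ 3) = √(T * h T) * h T := by
    rw [show (T : ℝ) * h T ^ 3 = T * h T * h T ^ 2 by ring, Real.sqrt_mul hT.le,
      Real.sqrt_sq hh.le]
  have h4 : 1 / √(T * h T) = √(T * h T) * (1 / (T * h T)) := by
    rw [mul_one_div, Real.sqrt_div_self']
  rw [h3, h4, mul_add]

theorem tendsto_sqrt_div (h_zero : Tendsto h atTop (𝓝 0))
    (h_lower : Tendsto (fun T : ℕ => (T : ℝ) * h T) atTop atTop) :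
    Tendsto (fun T : ℕ => √(T * h T) / T) atTop (𝓝 0) := by
  have h2 : Tendsto (fun T : ℕ => h T * (1 / √(T * h T))) atTop (𝓝 0) := by
    simpa using h_zero.mul ((Real.tendsto_sqrt_atTop.comp h_lower).const_div_atTop 1)
  refine h2.congr' ?_
  filter_upwards [h_lower.eventually_gt_atTop 0, eventually_bandwidth_pos h_lower] with T hT hh
  have hT0 : (0 : ℝ) < T := pos_of_mul_pos_left hT hh.le
  have hs := Real.sq_sqrt hT.le
  have hs0 : 0 < √(T * h T) := Real.sqrt_pos.2 hT
  rw [mul_one_div, div_eq_div_iff hs0.ne' hT0.ne', ← pow_two, hs, mul_comm]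

variable {K : ℝ → ℝ}

/-- The weights of the stochastic part of the smoother are negligible in mean square. -/
theorem IsKernel.tendsto_sum_smoothWeight_sq (hK : IsKernel K) {u : ℝ} (hu : u ∈ Ioo (0 : ℝ) 1)
    (h_zero : Tendsto h atTop (𝓝 0))
    (h_lower : Tendsto (fun T : ℕ => (T : ℝ) * h T) atTop atTop)
    {G : ℝ → ℝ} (hG : LipAt u G) :
    Tendsto (fun T : ℕ => ∑ t ∈ Finset.Icc 1 T,
      (1 / (T : ℝ) * scaledKernel K (h T) (u - t / T) * G (t / T)) ^ 2) atTop (𝓝 0) := by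
  obtain ⟨D, hD0, hD⟩ := hG.exists_bound hu
  have hpos := eventually_bandwidth_pos h_lower
  have hsq := hK.tendsto_kernelSum_sq hu hpos h_zero h_lower
  -- The sum of squares is `1/(Th)` times a quantity converging to a multiple of `∫ K²`.
  have hup : Tendsto (fun T : ℕ => D ^ 2 * ((1 / (T * h T)) * ((1 / (T * h T)) *
      ∑ t ∈ Finset.Icc 1 T, K ((h T)⁻¹ * (u - t / T)) ^ 2))) atTop (𝓝 0) := by
    simpa using ((h_lower.const_div_atTop 1).mul hsq).const_mul (D ^ 2)
  refine tendsto_of_tendsto_of_tendsto_of_le_of_le' tendsto_const_nhds hup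
    (Eventually.of_forall fun T => Finset.sum_nonneg fun t _ => sq_nonneg _) ?_
  filter_upwards [hpos] with T hh
  simp_rw [Finset.mul_sum]
  refine Finset.sum_le_sum fun t ht => ?_
  have hb : G (t / T) ^ 2 ≤ D ^ 2 := sq_le_sq.2 (by
    rw [abs_of_nonneg hD0]; exact hD _ (natCast_div_mem_Ioc ht))
  calc (1 / (T : ℝ) * scaledKernel K (h T) (u - t / T) * G (t / T)) ^ 2
      = (1 / (T * h T)) ^ 2 * K ((h T)⁻¹ * (u - t / T)) ^ 2 * G (t / T) ^ 2 := by
        rw [scaledKernel, one_div, one_div, mul_inv]; ring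
    _ ≤ (1 / (T * h T)) ^ 2 * K ((h T)⁻¹ * (u - t / T)) ^ 2 * D ^ 2 := by gcongr
    _ = _ := by ring

/-- The weights of the stochastic part of the remainder in the central limit theorem are
negligible in mean square. -/
theorem IsKernel.tendsto_sum_remainderWeight_sq (hK : IsKernel K) {u : ℝ}
    (hu : u ∈ Ioo (0 : ℝ) 1) (h_zero : Tendsto h atTop (𝓝 0))
    (h_lower : Tendsto (fun T : ℕ => (T : ℝ) * h T) atTop atTop)
    {G : ℝ → ℝ} (hG : LipAt u G) :
    Tendsto (fun T : ℕ => ∑ t ∈ Finset.Icc 1 T, (√(T * h T) / T *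
      (scaledKernel K (h T) (u - t / T) * (G (t / T) - G u) - G (t / T))) ^ 2) atTop (𝓝 0) := by
  obtain ⟨D, hD0, hD⟩ := hG.exists_bound hu
  obtain ⟨L, hL0, hL⟩ := hG
  obtain ⟨B, hB0, hB⟩ := hK.exists_bound
  obtain ⟨C, hC0, hC⟩ := hK.exists_kernelSum_abs_mul_le hu
  have hpos := eventually_bandwidth_pos h_lower
  have hup : Tendsto (fun T : ℕ => 2 * B * L ^ 2 * (C * (h T + 1 / (T * h T))) +
      2 * D ^ 2 * h T) atTop (𝓝 0) := by
    simpa using (((tendsto_rate h_zero h_lower).const_mul C).const_mul (2 * B * L ^ 2)).add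
      (h_zero.const_mul (2 * D ^ 2))
  refine tendsto_of_tendsto_of_tendsto_of_le_of_le' tendsto_const_nhds hup
    (Eventually.of_forall fun T => Finset.sum_nonneg fun t _ => sq_nonneg _) ?_
  filter_upwards [hpos, eventually_gt_atTop 0] with T hh hT
  have hT' : (0 : ℝ) < T := by exact_mod_cast hT
  have hterm : ∀ t ∈ Finset.Icc 1 T, (√(T * h T) / T *
      (scaledKernel K (h T) (u - t / T) * (G (t / T) - G u) - G (t / T))) ^ 2 ≤
      2 * B * L ^ 2 * (1 / (T * h T) * (|K ((h T)⁻¹ * (u - t / T))| * |(t : ℝ) / T - u|)) +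
        2 * D ^ 2 * h T * (1 / T) := fun t ht => by
    have hv := natCast_div_mem_Ioc ht
    have hG2 : G (t / T) ^ 2 ≤ D ^ 2 := sq_le_sq.2 (by
      rw [abs_of_nonneg hD0]; exact hD _ hv)
    -- One factor `|t/T - u| ≤ 1` is dropped, and one factor `|K| ≤ B` below, so that the
    -- first-moment bound for `|K|` suffices.
    have hd : (G (t / T) - G u) ^ 2 ≤ L ^ 2 * |(t : ℝ) / T - u| := by
      rw [← sq_abs]
      calc |G (t / T) - G u| ^ 2 ≤ (L * |(t : ℝ) / T - u|) ^ 2 := by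
            gcongr; exact hL _ hv
        _ = L ^ 2 * (|(t : ℝ) / T - u| * |(t : ℝ) / T - u|) := by ring
        _ ≤ L ^ 2 * (|(t : ℝ) / T - u| * 1) := by
            gcongr; exact abs_sub_le_one hu hv
        _ = _ := by ring
    have hk : K ((h T)⁻¹ * (u - t / T)) ^ 2 ≤ B * |K ((h T)⁻¹ * (u - t / T))| := by
      rw [← sq_abs, pow_two]
      exact mul_le_mul_of_nonneg_right (hB _) (abs_nonneg _)
    have hkd : K ((h T)⁻¹ * (u - t / T)) ^ 2 * (G (t / T) - G u) ^ 2 ≤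
        B * |K ((h T)⁻¹ * (u - t / T))| * (L ^ 2 * |(t : ℝ) / T - u|) :=
      mul_le_mul hk hd (sq_nonneg _) (by positivity)
    calc (√(T * h T) / T *
        (scaledKernel K (h T) (u - t / T) * (G (t / T) - G u) - G (t / T))) ^ 2
        = h T / T * (scaledKernel K (h T) (u - t / T) * (G (t / T) - G u) - G (t / T)) ^ 2 := by
          rw [mul_pow, div_pow, Real.sq_sqrt (by positivity)]
          field_simp
      _ ≤ h T / T * (2 * ((scaledKernel K (h T) (u - t / T) * (G (t / T) - G u)) ^ 2 +
            G (t / T) ^ 2)) := by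
          gcongr
          nlinarith [sq_nonneg (scaledKernel K (h T) (u - t / T) * (G (t / T) - G u) +
            G (t / T))]
      _ = 2 * (1 / (T * h T)) * (K ((h T)⁻¹ * (u - t / T)) ^ 2 * (G (t / T) - G u) ^ 2) +
            2 * G (t / T) ^ 2 * h T * (1 / T) := by
          rw [scaledKernel]
          field_simp
      _ ≤ 2 * (1 / (T * h T)) *
            (B * |K ((h T)⁻¹ * (u - t / T))| * (L ^ 2 * |(t : ℝ) / T - u|)) +
            2 * D ^ 2 * h T * (1 / T) := by gcongr
      _ = _ := by ring
  refine (Finset.sum_le_sum hterm).trans ?_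
  rw [Finset.sum_add_distrib, ← Finset.mul_sum, ← Finset.mul_sum, Finset.sum_const,
    Nat.card_Icc, Nat.add_sub_cancel, nsmul_eq_mul]
  refine add_le_add (mul_le_mul_of_nonneg_left (hC T hT _ hh) (by positivity)) (le_of_eq ?_)
  field_simp

/-- The normalized kernel weights satisfy the conditions of the central limit theorem. -/
theorem IsKernel.tendsto_sum_cltWeight_sq (hK : IsKernel K) {u : ℝ}
    (hu : u ∈ Ioo (0 : ℝ) 1) (h_zero : Tendsto h atTop (𝓝 0))
    (h_lower : Tendsto (fun T : ℕ => (T : ℝ) * h T) atTop atTop) :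
    Tendsto (fun T : ℕ => ∑ t ∈ Finset.Icc 1 T,
      (√(T * h T) / kernelNorm K * (1 / T * scaledKernel K (h T) (u - t / T))) ^ 2)
      atTop (𝓝 1) := by
  have hpos := eventually_bandwidth_pos h_lower
  have hsq := hK.tendsto_kernelSum_sq hu hpos h_zero h_lower
  have hn := hK.kernelNorm_pos
  have hlim := hsq.const_mul (1 / kernelNorm K ^ 2)
  rw [← IsKernel.kernelNorm_sq K, one_div_mul_cancel (by positivity)] at hlim
  refine hlim.congr' ?_
  filter_upwards [hpos, eventually_gt_atTop 0] with T hh hT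
  have hT' : (0 : ℝ) < T := by exact_mod_cast hT
  rw [Finset.mul_sum, Finset.mul_sum]
  refine Finset.sum_congr rfl fun t _ => ?_
  rw [scaledKernel, mul_pow, div_pow, Real.sq_sqrt (by positivity)]
  field_simp

/-- Each weight equals a value of `K` divided by `‖K‖₂ √(Th)`, and `K` is bounded. -/
theorem IsKernel.eventually_cltWeight_le (hK : IsKernel K) (u : ℝ)
    (h_lower : Tendsto (fun T : ℕ => (T : ℝ) * h T) atTop atTop) {δ : ℝ} (hδ : 0 < δ) :
    ∀ᶠ T : ℕ in atTop, ∀ t ∈ Finset.Icc 1 T,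
      |√(T * h T) / kernelNorm K * (1 / T * scaledKernel K (h T) (u - t / T))| ≤ δ := by
  obtain ⟨B, hB0, hB⟩ := hK.exists_bound
  have hn := hK.kernelNorm_pos
  have hlim : Tendsto (fun T : ℕ => B / kernelNorm K / √(T * h T)) atTop (𝓝 0) :=
    (Real.tendsto_sqrt_atTop.comp h_lower).const_div_atTop _
  filter_upwards [eventually_bandwidth_pos h_lower, eventually_gt_atTop 0,
    hlim.eventually_le_const hδ] with T hh hT hle t _
  have hT' : (0 : ℝ) < T := by exact_mod_cast hT
  refine le_trans ?_ hle
  have hpos : 0 < T * h T := by positivity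
  have hs0 : 0 < √(T * h T) := Real.sqrt_pos.2 hpos
  have hs := Real.sq_sqrt hpos.le
  have heq : √(T * h T) / kernelNorm K * (1 / T * scaledKernel K (h T) (u - t / T)) =
      K ((h T)⁻¹ * (u - t / T)) / kernelNorm K / √(T * h T) := by
    rw [eq_div_iff hs0.ne']
    calc √(T * h T) / kernelNorm K * (1 / T * scaledKernel K (h T) (u - t / T)) * √(T * h T)
        = √(T * h T) ^ 2 / kernelNorm K * (1 / T * scaledKernel K (h T) (u - t / T)) := by ring
      _ = _ := by
        rw [hs, scaledKernel]
        field_simp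
  rw [heq, abs_div, abs_div, abs_of_pos hn, abs_of_pos hs0]
  gcongr
  exact hB _

end Bandwidth

/-! ### Convergence in probability and Slutsky's theorem -/

section Convergence

variable {Ω : Type*} [MeasurableSpace Ω] {P : Measure Ω}

theorem tendstoInMeasure_add_of_tendsto {S : ℕ → Ω → ℝ} (hS : TendstoInMeasure P S atTop fun _ => 0)
    {b : ℕ → ℝ} {c : ℝ} (hb : Tendsto b atTop (𝓝 c)) :
    TendstoInMeasure P (fun T ω => S T ω + b T) atTop fun _ => c := by
  rw [tendstoInMeasure_iff_norm] at hS ⊢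
  intro ε hε
  refine tendsto_of_tendsto_of_tendsto_of_le_of_le' tendsto_const_nhds (hS (ε / 2) (by positivity))
    (Eventually.of_forall fun _ => zero_le) ?_
  filter_upwards [Metric.tendsto_nhds.1 hb (ε / 2) (by positivity)] with T hT
  refine measure_mono fun ω hω => ?_
  simp only [mem_ofPred_eq, sub_zero, Real.norm_eq_abs] at hω ⊢
  rw [Real.dist_eq] at hT
  have := abs_add_le (S T ω) (b T - c)
  rw [← add_sub_assoc] at this
  linarith

theorem tendstoInMeasure_pi {ι : Type*} [Fintype ι] {E : ι → Type*}
    [∀ i, PseudoMetricSpace (E i)] {B : ℕ → Ω → ∀ i, E i} {C : ∀ i, E i}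
    (hB : ∀ i, TendstoInMeasure P (fun T ω => B T ω i) atTop fun _ => C i) :
    TendstoInMeasure P B atTop fun _ => C := by
  rw [tendstoInMeasure_iff_dist]
  intro ε hε
  have hsum : Tendsto (fun T => ∑ i, P {ω | ε ≤ dist (B T ω i) (C i)}) atTop (𝓝 0) := by
    rw [← Finset.sum_const_zero (s := (Finset.univ : Finset ι))]
    exact tendsto_finsetSum _ fun i _ => tendstoInMeasure_iff_dist.1 (hB i) ε hε
  refine tendsto_of_tendsto_of_tendsto_of_le_of_le tendsto_const_nhds hsum
    (fun _ => zero_le) fun T => ?_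
  refine (measure_mono fun ω hω => ?_).trans (measure_biUnion_finset_le Finset.univ _)
  simp only [Finset.mem_univ, iUnion_true, mem_iUnion, mem_ofPred_eq] at hω ⊢
  by_contra! hcon
  exact hω.not_gt ((dist_pi_lt_iff hε).2 hcon)

/-- Slutsky's theorem for a negligible additive remainder, entry by entry. -/
theorem tendstoInDistribution_of_eq_add {p : ℕ} {Ω' : Type*} [MeasurableSpace Ω']
    {P' : Measure Ω'} [IsProbabilityMeasure P'] [IsProbabilityMeasure P]
    {N R W : ℕ → Ω → Fin p → Fin p → ℝ} {Z : Ω' → Fin p → Fin p → ℝ}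
    (hN : TendstoInDistribution N atTop Z (fun _ => P) P')
    (hR : ∀ i j, TendstoInMeasure P (fun T ω => R T ω i j) atTop fun _ => 0)
    (hRm : ∀ T i j, AEMeasurable (fun ω => R T ω i j) P)
    (hW : ∀ T ω i j, W T ω i j = N T ω i j + R T ω i j) :
    TendstoInDistribution W atTop Z (fun _ => P) P' := by
  have hR' : TendstoInMeasure P R atTop fun _ => (0 : Fin p → Fin p → ℝ) :=
    tendstoInMeasure_pi fun i => tendstoInMeasure_pi fun j => hR i j
  have h := hN.add_of_tendstoInMeasure_const hR'
    fun T => aemeasurable_pi_iff.2 fun i => aemeasurable_pi_iff.2 fun j => hRm T i j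
  have hWeq : W = fun T => N T + R T := by
    funext T ω i j
    exact hW T ω i j
  simpa only [add_zero, hWeq] using h

end Convergence

/-! ### Decomposition of the estimators -/

section Estimators

variable {p : ℕ} {Ω : Type*}

/-- Writing `y_k y_l` as its centred version plus `δ_kl` separates noise from mean; the `δ_kl` terms
sum to `A²`. -/
theorem vecMulVec_X_apply (A : ℝ → Matrix (Fin p) (Fin p) ℝ) (Y : ℕ → Ω → Fin p → ℝ)
    (T t : ℕ) (ω : Ω) (i j : Fin p) :
    Matrix.vecMulVec (X A Y T t ω) (X A Y T t ω) i j =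
      ∑ q : Fin p × Fin p, A (t / T) i q.1 * A (t / T) j q.2 * centeredProd q.1 q.2 (Y t ω) +
        sq A (t / T) i j := by
  simp only [Matrix.vecMulVec_apply, X, Matrix.mulVec, dotProduct, sq, Matrix.mul_apply,
    Matrix.transpose_apply, centeredProd, Finset.sum_mul_sum, mul_sub, Finset.sum_sub_distrib,
    Fintype.sum_prod_type]
  rw [eq_comm]
  simp only [mul_ite, mul_one, mul_zero, Finset.sum_ite_eq, Finset.mem_univ, if_true,
    sub_add_cancel]
  exact Finset.sum_congr rfl fun k _ => Finset.sum_congr rfl fun l _ => by ring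

theorem sqHat_apply (A : ℝ → Matrix (Fin p) (Fin p) ℝ) (Y : ℕ → Ω → Fin p → ℝ) (K : ℝ → ℝ)
    (T : ℕ) (h u : ℝ) (ω : Ω) (i j : Fin p) :
    sqHat A Y K T h u ω i j =
      ∑ t ∈ Finset.Icc 1 T, ∑ q : Fin p × Fin p, 1 / (T : ℝ) * scaledKernel K h (u - t / T) *
        (A (t / T) i q.1 * A (t / T) j q.2) * centeredProd q.1 q.2 (Y t ω) +
      1 / (T : ℝ) * ∑ t ∈ Finset.Icc 1 T, scaledKernel K h (u - t / T) * sq A (t / T) i j := by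
  simp only [sqHat, Matrix.smul_apply, Matrix.sum_apply, vecMulVec_X_apply, smul_eq_mul,
    Finset.mul_sum, ← Finset.sum_add_distrib, mul_add]
  refine Finset.sum_congr rfl fun t _ => ?_
  congr 1
  exact Finset.sum_congr rfl fun q _ => by ring

theorem sqMeanHat_apply (A : ℝ → Matrix (Fin p) (Fin p) ℝ) (Y : ℕ → Ω → Fin p → ℝ)
    (T : ℕ) (ω : Ω) (i j : Fin p) :
    sqMeanHat A Y T ω i j =
      ∑ t ∈ Finset.Icc 1 T, ∑ q : Fin p × Fin p, 1 / (T : ℝ) *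
        (A (t / T) i q.1 * A (t / T) j q.2) * centeredProd q.1 q.2 (Y t ω) +
      1 / (T : ℝ) * ∑ t ∈ Finset.Icc 1 T, sq A (t / T) i j := by
  simp only [sqMeanHat, Matrix.smul_apply, Matrix.sum_apply, vecMulVec_X_apply, smul_eq_mul,
    Finset.mul_sum, ← Finset.sum_add_distrib, mul_add]
  refine Finset.sum_congr rfl fun t _ => ?_
  congr 1
  exact Finset.sum_congr rfl fun q _ => by ring

theorem isSelfAdjoint_sqHat (A : ℝ → Matrix (Fin p) (Fin p) ℝ) (Y : ℕ → Ω → Fin p → ℝ)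
    (K : ℝ → ℝ) (T : ℕ) (h u : ℝ) (ω : Ω) : IsSelfAdjoint (sqHat A Y K T h u ω) := by
  rw [isSelfAdjoint_iff, Matrix.star_eq_conjTranspose, Matrix.conjTranspose_eq_transpose_of_trivial]
  ext i j
  simp only [sqHat, Matrix.transpose_apply, Matrix.smul_apply, Matrix.sum_apply,
    Matrix.vecMulVec_apply, mul_comm]

/-- The summands are the noise with coefficients frozen at `u`, the noise left over from freezing
and from the global mean, and the bias. -/
theorem MHat_sub_M_apply (A : ℝ → Matrix (Fin p) (Fin p) ℝ) (Y : ℕ → Ω → Fin p → ℝ) (K : ℝ → ℝ)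
    (T : ℕ) (h u : ℝ) (ω : Ω) (i j : Fin p) :
    (MHat A Y K T h u ω - M A u) i j =
      ∑ t ∈ Finset.Icc 1 T, 1 / (T : ℝ) * scaledKernel K h (u - t / T) *
        ∑ q : Fin p × Fin p, A u i q.1 * A u j q.2 * centeredProd q.1 q.2 (Y t ω) +
      (∑ t ∈ Finset.Icc 1 T, ∑ q : Fin p × Fin p, 1 / (T : ℝ) *
        (scaledKernel K h (u - t / T) * (A (t / T) i q.1 * A (t / T) j q.2 -
          A u i q.1 * A u j q.2) - A (t / T) i q.1 * A (t / T) j q.2) *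
            centeredProd q.1 q.2 (Y t ω) +
      ((1 / (T : ℝ) * ∑ t ∈ Finset.Icc 1 T, scaledKernel K h (u - t / T) * sq A (t / T) i j -
          sq A u i j) -
        (1 / (T : ℝ) * ∑ t ∈ Finset.Icc 1 T, sq A (t / T) i j -
          ∫ v in (0 : ℝ)..1, sq A v i j))) := by
  have hsplit : ∑ t ∈ Finset.Icc 1 T, ∑ q : Fin p × Fin p, 1 / (T : ℝ) *
        scaledKernel K h (u - t / T) *
          (A (t / T) i q.1 * A (t / T) j q.2) * centeredProd q.1 q.2 (Y t ω) -
      ∑ t ∈ Finset.Icc 1 T, ∑ q : Fin p × Fin p, 1 / (T : ℝ) *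
        (A (t / T) i q.1 * A (t / T) j q.2) * centeredProd q.1 q.2 (Y t ω) =
      ∑ t ∈ Finset.Icc 1 T, 1 / (T : ℝ) * scaledKernel K h (u - t / T) *
        ∑ q : Fin p × Fin p, A u i q.1 * A u j q.2 * centeredProd q.1 q.2 (Y t ω) +
      ∑ t ∈ Finset.Icc 1 T, ∑ q : Fin p × Fin p, 1 / (T : ℝ) *
        (scaledKernel K h (u - t / T) * (A (t / T) i q.1 * A (t / T) j q.2 -
          A u i q.1 * A u j q.2) - A (t / T) i q.1 * A (t / T) j q.2) *
            centeredProd q.1 q.2 (Y t ω) := by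
    rw [← Finset.sum_sub_distrib, ← Finset.sum_add_distrib]
    refine Finset.sum_congr rfl fun t _ => ?_
    rw [← Finset.sum_sub_distrib, Finset.mul_sum, ← Finset.sum_add_distrib]
    refine Finset.sum_congr rfl fun q _ => ?_
    ring
  simp only [Matrix.sub_apply, MHat, M, sqMean, Matrix.of_apply, sqHat_apply, sqMeanHat_apply]
  linear_combination hsplit

theorem sq_eq_sum (A : ℝ → Matrix (Fin p) (Fin p) ℝ) (i j : Fin p) :
    (fun v => sq A v i j) = fun v => ∑ k, A v i k * A v j k := by
  ext v
  simp [sq, Matrix.mul_apply]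

end Estimators

/-! ### Consistency and normality at `A(u) = 1` -/

section Asymptotics

variable {p : ℕ} {Ω : Type*} [MeasurableSpace Ω] {P : Measure Ω} [IsProbabilityMeasure P]
  {ν : Measure ℝ} [IsProbabilityMeasure ν] {Y : ℕ → Ω → Fin p → ℝ}
  {A : ℝ → Matrix (Fin p) (Fin p) ℝ} {u : ℝ} {K : ℝ → ℝ} {h : ℕ → ℝ}

theorem lipAt_sq (hu : u ∈ Ioo (0 : ℝ) 1)
    (hA_lip : ∀ i j, ∃ L, LipschitzOnWith L (fun v => A v i j) (Ioo 0 1)) (i j : Fin p) :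
    LipAt u fun v => sq A v i j := by
  rw [sq_eq_sum]
  exact LipAt.sum _ fun k _ =>
    (LipAt.of_lipschitzOnWith hu (hA_lip i k)).mul hu (LipAt.of_lipschitzOnWith hu (hA_lip j k))

theorem extendsBV_sq
    (hA_lip : ∀ i j, ∃ L, LipschitzOnWith L (fun v => A v i j) (Ioo 0 1)) (i j : Fin p) :
    ExtendsBV fun v => sq A v i j := by
  rw [sq_eq_sum]
  exact ExtendsBV.sum _ fun k _ =>
    (ExtendsBV.of_lipschitzOnWith (hA_lip i k)).mul (ExtendsBV.of_lipschitzOnWith (hA_lip j k))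

theorem tendstoInProb_sqHat (hν_four : MemLp (fun y : ℝ => y) 4 ν)
    (hν_mean : ∫ y, y ∂ν = 0) (hν_var : ∫ y, y ^ 2 ∂ν = 1)
    (hlaw : ∀ t, HasLaw (Y t) (Measure.pi fun _ => ν) P) (hindep : iIndepFun Y P)
    (hA_lip : ∀ i j, ∃ L, LipschitzOnWith L (fun v => A v i j) (Ioo 0 1))
    (hu : u ∈ Ioo (0 : ℝ) 1) (hK : IsKernel K) (h_zero : Tendsto h atTop (𝓝 0))
    (h_lower : Tendsto (fun T : ℕ => (T : ℝ) * h T) atTop atTop) :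
    TendstoInProb P (fun T ω => sqHat A Y K T (h T) u ω) (sq A u) := by
  intro i j
  simp_rw [sqHat_apply]
  refine tendstoInMeasure_add_of_tendsto (tendstoInMeasure_centeredSum hν_four hν_mean hν_var
    hlaw hindep (c := fun T t q => 1 / (T : ℝ) * scaledKernel K (h T) (u - t / T) *
      (A (t / T) i q.1 * A (t / T) j q.2)) (s := fun T => Finset.Icc 1 T) fun q => ?_) ?_
  · exact hK.tendsto_sum_smoothWeight_sq (G := fun v => A v i q.1 * A v j q.2) hu h_zero h_lower
      ((LipAt.of_lipschitzOnWith hu (hA_lip i q.1)).mul hu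
        (LipAt.of_lipschitzOnWith hu (hA_lip j q.2)))
  · obtain ⟨C, -, hC⟩ := hK.exists_abs_smooth_sub_le hu (lipAt_sq hu hA_lip i j)
    rw [tendsto_iff_norm_sub_tendsto_zero]
    have hup := (tendsto_rate h_zero h_lower).const_mul C
    rw [mul_zero] at hup
    refine squeeze_zero' (Eventually.of_forall fun _ => norm_nonneg _) ?_ hup
    filter_upwards [eventually_bandwidth_pos h_lower, eventually_gt_atTop 0] with T hh hT
    exact hC T hT _ hh

/-- The centred bias of the estimator is negligible at the rate `√(T h)`. -/
theorem tendsto_sqrt_mul_bias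
    (hA_lip : ∀ i j, ∃ L, LipschitzOnWith L (fun v => A v i j) (Ioo 0 1))
    (hu : u ∈ Ioo (0 : ℝ) 1) (hK : IsKernel K) (h_zero : Tendsto h atTop (𝓝 0))
    (h_lower : Tendsto (fun T : ℕ => (T : ℝ) * h T) atTop atTop)
    (h_upper : Tendsto (fun T : ℕ => (T : ℝ) * h T ^ 3) atTop (𝓝 0)) (i j : Fin p) :
    Tendsto (fun T : ℕ => √(T * h T) *
      ((1 / (T : ℝ) * ∑ t ∈ Finset.Icc 1 T, scaledKernel K (h T) (u - t / T) * sq A (t / T) i j -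
          sq A u i j) -
        (1 / (T : ℝ) * ∑ t ∈ Finset.Icc 1 T, sq A (t / T) i j -
          ∫ v in (0 : ℝ)..1, sq A v i j))) atTop (𝓝 0) := by
  obtain ⟨C, -, hC⟩ := hK.exists_abs_smooth_sub_le hu (lipAt_sq hu hA_lip i j)
  obtain ⟨C', -, hC'⟩ := (extendsBV_sq hA_lip i j).exists_abs_riemannSum_sub_le
  have hup := ((tendsto_sqrt_mul_rate h_lower h_upper).const_mul C).add
    ((tendsto_sqrt_div h_zero h_lower).const_mul C')
  rw [mul_zero, mul_zero, add_zero] at hup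
  refine squeeze_zero_norm' ?_ hup
  filter_upwards [eventually_bandwidth_pos h_lower, eventually_gt_atTop 0] with T hh hT
  have h1 := hC T hT _ hh
  have h2 := hC' T hT
  rw [norm_mul, Real.norm_of_nonneg (Real.sqrt_nonneg _), Real.norm_eq_abs]
  calc _ ≤ √(T * h T) * (C * (h T + 1 / (T * h T)) + C' / T) :=
        mul_le_mul_of_nonneg_left ((abs_sub _ _).trans (add_le_add h1 h2)) (Real.sqrt_nonneg _)
    _ = _ := by ring

/-- Asymptotic normality at a point where the coefficient matrix is the identity. -/
theorem tendstoInDistribution_MHat_of_eq_one (hν_four : MemLp (fun y : ℝ => y) 4 ν)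
    (hν_mean : ∫ y, y ∂ν = 0) (hν_var : ∫ y, y ^ 2 ∂ν = 1) (hμ4 : 0 < mu4 ν)
    (hlaw : ∀ t, HasLaw (Y t) (Measure.pi fun _ => ν) P) (hindep : iIndepFun Y P)
    (hA_lip : ∀ i j, ∃ L, LipschitzOnWith L (fun v => A v i j) (Ioo 0 1)) (hA : A u = 1)
    (hu : u ∈ Ioo (0 : ℝ) 1) (hK : IsKernel K) (h_zero : Tendsto h atTop (𝓝 0))
    (h_lower : Tendsto (fun T : ℕ => (T : ℝ) * h T) atTop atTop)
    (h_upper : Tendsto (fun T : ℕ => (T : ℝ) * h T ^ 3) atTop (𝓝 0)) :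
    TendstoInDistribution
      (fun (T : ℕ) ω i j => √((T : ℝ) * h T) / (kernelNorm K * √(mu4 ν)) *
        (MHat A Y K T (h T) u ω - M A u) i j)
      atTop symmOf (fun _ => P) (gaussianEntries p (mu4 ν)) := by
  have hclt := tendstoInDistribution_centeredSum hν_four hν_mean hν_var hμ4 hlaw hindep
    (w := fun (T : ℕ) t => √(T * h T) / kernelNorm K *
      (1 / T * scaledKernel K (h T) (u - t / T))) (s := fun T => Finset.Icc 1 T)
    (fun δ hδ => hK.eventually_cltWeight_le u h_lower hδ)
    (hK.tendsto_sum_cltWeight_sq hu h_zero h_lower)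
  -- At `A(u) = 1` the frozen combination collapses to a single centred product.
  have hone : ∀ (i j : Fin p) (y : Fin p → ℝ),
      ∑ q : Fin p × Fin p, A u i q.1 * A u j q.2 * centeredProd q.1 q.2 y =
        centeredProd i j y := fun i j y => by
    simp [hA, Matrix.one_apply, Fintype.sum_prod_type]
  have hn := hK.kernelNorm_pos
  have hm : 0 < √(mu4 ν) := Real.sqrt_pos.2 hμ4
  set c : Fin p → Fin p → ℕ → ℕ → Fin p × Fin p → ℝ := fun i j T t q =>
    1 / (kernelNorm K * √(mu4 ν)) * (√(T * h T) / T *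
      (scaledKernel K (h T) (u - t / T) * (A (t / T) i q.1 * A (t / T) j q.2 -
        A u i q.1 * A u j q.2) - A (t / T) i q.1 * A (t / T) j q.2)) with hc
  set b : Fin p → Fin p → ℕ → ℝ := fun i j T => 1 / (kernelNorm K * √(mu4 ν)) *
    (√(T * h T) * ((1 / (T : ℝ) * ∑ t ∈ Finset.Icc 1 T,
          scaledKernel K (h T) (u - t / T) * sq A (t / T) i j - sq A u i j) -
        (1 / (T : ℝ) * ∑ t ∈ Finset.Icc 1 T, sq A (t / T) i j -
          ∫ v in (0 : ℝ)..1, sq A v i j))) with hb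
  have hdecomp : ∀ (T : ℕ) (ω : Ω) (i j : Fin p), √((T : ℝ) * h T) / (kernelNorm K * √(mu4 ν)) *
      (MHat A Y K T (h T) u ω - M A u) i j =
      ∑ t ∈ Finset.Icc 1 T, √(T * h T) / kernelNorm K *
        (1 / T * scaledKernel K (h T) (u - t / T)) * (centeredProd i j (Y t ω) / √(mu4 ν)) +
      (∑ t ∈ Finset.Icc 1 T, ∑ q, c i j T t q * centeredProd q.1 q.2 (Y t ω) + b i j T) := by
    intro T ω i j
    rw [MHat_sub_M_apply, mul_add, mul_add, hb, hc]
    simp only [hone]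
    congr 1
    · rw [Finset.mul_sum]
      refine Finset.sum_congr rfl fun t _ => ?_
      field_simp
    · congr 1
      · rw [Finset.mul_sum]
        refine Finset.sum_congr rfl fun t _ => ?_
        rw [Finset.mul_sum]
        refine Finset.sum_congr rfl fun q _ => ?_
        ring
      · ring
  have hR : ∀ i j, TendstoInMeasure P (fun T ω =>
      ∑ t ∈ Finset.Icc 1 T, ∑ q, c i j T t q * centeredProd q.1 q.2 (Y t ω) + b i j T)
      atTop fun _ => 0 := by
    intro i j
    refine tendstoInMeasure_add_of_tendsto (tendstoInMeasure_centeredSum hν_four hν_mean hν_var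
      hlaw hindep (c := c i j) (s := fun T => Finset.Icc 1 T) fun q => ?_) ?_
    · have := (hK.tendsto_sum_remainderWeight_sq (G := fun v => A v i q.1 * A v j q.2) hu h_zero
        h_lower ((LipAt.of_lipschitzOnWith hu (hA_lip i q.1)).mul hu
          (LipAt.of_lipschitzOnWith hu (hA_lip j q.2)))).const_mul
            ((1 / (kernelNorm K * √(mu4 ν))) ^ 2)
      rw [mul_zero] at this
      simpa only [hc, mul_pow _ _ 2, ← Finset.mul_sum] using this
    · have := (tendsto_sqrt_mul_bias hA_lip hu hK h_zero h_lower h_upper i j).const_mul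
        (1 / (kernelNorm K * √(mu4 ν)))
      rwa [mul_zero] at this
  exact tendstoInDistribution_of_eq_add hclt hR
    (fun T i j => (aemeasurable_centeredSum hlaw (c i j T) _).add_const _) hdecomp

end Asymptotics

/-! ### Congruence equivariance -/

section Equivariance

variable {p : ℕ} {Ω : Type*} (S : Matrix (Fin p) (Fin p) ℝ) (A : ℝ → Matrix (Fin p) (Fin p) ℝ)

theorem sq_mul_left (v : ℝ) : sq (fun v => S * A v) v = S * sq A v * Sᵀ := by
  simp only [sq, Matrix.transpose_mul, Matrix.mul_assoc]

theorem vecMulVec_X_mul_left (Y : ℕ → Ω → Fin p → ℝ) (T t : ℕ) (ω : Ω) :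
    Matrix.vecMulVec (X (fun v => S * A v) Y T t ω) (X (fun v => S * A v) Y T t ω) =
      S * Matrix.vecMulVec (X A Y T t ω) (X A Y T t ω) * Sᵀ := by
  rw [Matrix.mul_vecMulVec, Matrix.vecMulVec_mul, Matrix.vecMul_transpose]
  simp only [X, Matrix.mulVec_mulVec]

theorem MHat_mul_left (Y : ℕ → Ω → Fin p → ℝ) (K : ℝ → ℝ) (T : ℕ) (h u : ℝ) (ω : Ω) :
    MHat (fun v => S * A v) Y K T h u ω = S * MHat A Y K T h u ω * Sᵀ := by
  simp only [MHat, sqHat, sqMeanHat, vecMulVec_X_mul_left, Matrix.mul_sub, Matrix.sub_mul,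
    Matrix.mul_smul, Matrix.smul_mul, Matrix.mul_sum, Matrix.sum_mul]

/-- Integrability is what allows the integral to be exchanged with the finite sums. -/
theorem sqMean_mul_left
    (hA : ∀ i j, IntervalIntegrable (fun v => sq A v i j) volume 0 1) :
    sqMean (fun v => S * A v) = S * sqMean A * Sᵀ := by
  ext i j
  simp only [sqMean, Matrix.of_apply, sq_mul_left, Matrix.mul_apply, Matrix.transpose_apply]
  rw [intervalIntegral.integral_finsetSum]
  · refine Finset.sum_congr rfl fun l _ => ?_
    rw [intervalIntegral.integral_mul_const, intervalIntegral.integral_finsetSum]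
    · simp only [intervalIntegral.integral_const_mul]
    · exact fun k _ => (hA k l).const_mul _
  · intro l _
    have := (IntervalIntegrable.sum Finset.univ fun k _ => (hA k l).const_mul (S i k)).mul_const
      (S j l)
    simpa only [Finset.sum_apply] using this

theorem M_mul_left (hA : ∀ i j, IntervalIntegrable (fun v => sq A v i j) volume 0 1) (u : ℝ) :
    M (fun v => S * A v) u = S * M A u * Sᵀ := by
  simp only [M, sq_mul_left, sqMean_mul_left S A hA, Matrix.mul_sub, Matrix.sub_mul]

theorem lipschitzOnWith_mul_left {s : Set ℝ}
    (hA_lip : ∀ i j, ∃ L, LipschitzOnWith L (fun v => A v i j) s) (i j : Fin p) :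
    ∃ L, LipschitzOnWith L (fun v => (S * A v) i j) s := by
  choose L hL using hA_lip
  refine ⟨∑ k, ‖S i k‖₊ * L k j, LipschitzOnWith.of_dist_le_mul fun v hv w hw => ?_⟩
  simp only [Matrix.mul_apply, Real.dist_eq, ← Finset.sum_sub_distrib, ← mul_sub]
  push_cast
  rw [Finset.sum_mul]
  refine (Finset.abs_sum_le_sum_abs _ _).trans (Finset.sum_le_sum fun k _ => ?_)
  rw [abs_mul, mul_assoc, Real.norm_eq_abs]
  refine mul_le_mul_of_nonneg_left ?_ (abs_nonneg _)
  simpa only [Real.dist_eq] using (hL k j).dist_le_mul v hv w hw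

end Equivariance

end VCModel

end

/-! ### Assembly of the limit theorem and consistency -/

theorem proposition4p1 {p : ℕ} {Ω : Type*} [MeasurableSpace Ω] (P : Measure Ω)
    [IsProbabilityMeasure P]
    -- all the entries `Y_{i,t}` are i.i.d. with law `ν`, of mean zero and variance one,
    -- with finite fourth moment and `μ₄ > 0`
    (ν : Measure ℝ) [IsProbabilityMeasure ν]
    (Y : ℕ → Ω → Fin p → ℝ)
    (hY_law : ∀ t i, HasLaw (fun ω => Y t ω i) ν P)
    (hY_indep : iIndepFun (fun (q : ℕ × Fin p) ω => Y q.1 ω q.2) P)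
    (hν_four : MemLp (fun y : ℝ => y) 4 ν)
    (hν_mean : ∫ y, y ∂ν = 0)
    (hν_var : ∫ y, y ^ 2 ∂ν = 1)
    (hμ4 : 0 < VCModel.mu4 ν)
    -- the entries of `A` are Lipschitz on `(0,1)`
    (A : ℝ → Matrix (Fin p) (Fin p) ℝ)
    (hA_lip : ∀ i j, ∃ L, LipschitzOnWith L (fun v => A v i j) (Ioo 0 1))
    (u : ℝ) (hu : u ∈ Ioo (0 : ℝ) 1) (hA_inv : IsUnit (A u).det)
    (K : ℝ → ℝ) (hK : VCModel.IsKernel K)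
    -- the bandwidth, as a function of the sample size `T`
    (h : ℕ → ℝ)
    (h_zero : Tendsto h atTop (𝓝 0))
    (h_lower : Tendsto (fun T : ℕ => (T : ℝ) * h T) atTop atTop)
    (h_upper : Tendsto (fun T : ℕ => (T : ℝ) * h T ^ 3) atTop (𝓝 0)) :
    -- asymptotic normality
    TendstoInDistribution
      (fun (T : ℕ) ω i j =>
        ((√((T : ℝ) * h T) / (VCModel.kernelNorm K * √(VCModel.mu4 ν))) •
          ((A u)⁻¹ * (VCModel.MHat A Y K T (h T) u ω - VCModel.M A u) * ((A u)ᵀ)⁻¹)) i j)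
      atTop VCModel.symmOf (fun _ => P) (VCModel.gaussianEntries p (VCModel.mu4 ν)) ∧
    -- consistency for `k = 2`, `k = -2`
    VCModel.TendstoInProb P (fun T ω => VCModel.sqHat A Y K T (h T) u ω) (VCModel.sq A u) ∧
    VCModel.TendstoInProb P (fun T ω => (VCModel.sqHat A Y K T (h T) u ω)⁻¹)
      (VCModel.sq A u)⁻¹ ∧
    -- consistency for `k = 1`, `k = -1`, with the square root of `A²(u)` as the limit
    VCModel.TendstoInProb P (fun T ω => VCModel.rootHat A Y K T (h T) u ω)
      (VCModel.root (VCModel.sq A u)) ∧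
    VCModel.TendstoInProb P (fun T ω => (VCModel.rootHat A Y K T (h T) u ω)⁻¹)
      (VCModel.root (VCModel.sq A u))⁻¹ ∧
    -- consistency for `k = 1`, `k = -1`, with `A(u)` itself as the limit: `A(u)` is a root of
    -- `A²(u)` up to an orthogonal factor, which is trivial if `A(u)` is positive definite
    ∃ Q ∈ Matrix.orthogonalGroup (Fin p) ℝ,
      VCModel.root (VCModel.sq A u) * Q = A u ∧
      ((A u).PosDef → Q = 1) ∧
      VCModel.TendstoInProb P (fun T ω => VCModel.rootHat A Y K T (h T) u ω * Q) (A u) ∧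
      VCModel.TendstoInProb P (fun T ω => (VCModel.rootHat A Y K T (h T) u ω * Q)⁻¹) (A u)⁻¹ := by
  have hlaw := VCModel.hasLaw_row hY_law hY_indep
  have hindep := VCModel.iIndepFun_rows hY_law hY_indep
  have hsqHat := VCModel.tendstoInProb_sqHat hν_four hν_mean hν_var hlaw hindep hA_lip hu hK
    h_zero h_lower
  have hsqdet : IsUnit (VCModel.sq A u).det := by
    rw [VCModel.sq, Matrix.det_mul, Matrix.det_transpose]
    exact hA_inv.mul hA_inv
  obtain ⟨hroot_det, Q, hQ, hQA, hQ1⟩ := VCModel.exists_root_mul_orthogonal hA_inv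
  have hsa : VCModel.sq A u ∈ {S : Matrix (Fin p) (Fin p) ℝ | IsSelfAdjoint S} :=
    (Matrix.isHermitian_mul_conjTranspose_self (A u) :)
  -- Continuity of the root is available only within symmetric matrices, where every estimate lies.
  have hroot : VCModel.TendstoInProb P (fun T ω => VCModel.rootHat A Y K T (h T) u ω)
      (VCModel.root (VCModel.sq A u)) :=
    hsqHat.comp (fun T ω => VCModel.isSelfAdjoint_sqHat A Y K T (h T) u ω)
      (VCModel.continuousOn_root _ hsa)
  have hrootQ : VCModel.TendstoInProb P (fun T ω => VCModel.rootHat A Y K T (h T) u ω * Q) (A u) := by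
    have := hroot.comp (s := univ) (fun _ _ => mem_univ _) (f := fun R => R * Q)
      (by fun_prop : Continuous fun R : Matrix (Fin p) (Fin p) ℝ => R * Q).continuousWithinAt
    rwa [show VCModel.root (VCModel.sq A u) * Q = A u from hQA] at this
  refine ⟨?_, hsqHat, ?_, hroot, ?_, Q, hQ, hQA, hQ1, hrootQ, ?_⟩
  -- The normalised model `v ↦ A(u)⁻¹ A(v)` is the identity at `u`; equivariance transfers its limit
  -- back.
  · have hB := VCModel.tendstoInDistribution_MHat_of_eq_one (A := fun v => (A u)⁻¹ * A v)
      hν_four hν_mean hν_var hμ4 hlaw hindep (VCModel.lipschitzOnWith_mul_left _ A hA_lip)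
      (Matrix.nonsing_inv_mul _ hA_inv) hu hK h_zero h_lower h_upper
    have hint : ∀ i j, IntervalIntegrable (fun v => VCModel.sq A v i j) volume 0 1 :=
      fun i j => (VCModel.extendsBV_sq hA_lip i j).intervalIntegrable
    simpa only [VCModel.MHat_mul_left, VCModel.M_mul_left _ A hint, ← Matrix.mul_sub,
      ← Matrix.sub_mul, Matrix.transpose_nonsing_inv, Matrix.smul_apply, smul_eq_mul] using hB
  · exact hsqHat.comp (s := univ) (fun _ _ => mem_univ _)
      (VCModel.continuousAt_inv hsqdet).continuousWithinAt
  · exact hroot.comp (s := univ) (fun _ _ => mem_univ _)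
      (VCModel.continuousAt_inv hroot_det).continuousWithinAt
  · exact hrootQ.comp (s := univ) (fun _ _ => mem_univ _)
      (VCModel.continuousAt_inv hA_inv).continuousWithinAt
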